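/- Let $\mathbb H$ be a \emph{Hurewicz topos}, i.e. an elementary topos (a finitely complete category in which the functor $\mathrm{Sub}(A\times -)$ is representable for every object $A$) with a natural numbers object $\mathbf N$ and a distinguished \emph{elementary interval}: an object $I$ such that $\mathbf 2^I\cong\mathbf 2$, where $\mathbf 2=\mathbf 1+\mathbf 1$, which has precisely two distinct global elements $\#0,\#1:\mathbf 1\to I$, and such that every map $u:I\to X$ is determined by $u(\#0)$ and $u(\#1)$. Let $I_0=\mathbf 1$ and let $I_{n}=I_{n-1}+_{\mathbf 1}I$ be obtained by gluing the last point of $I_{n-1}$ to the point $\#0$ of $I$, so that $I_n$ has points $\#0,\dots,\#n$; for $\sigma\in X^{I_n}$ write $\sigma_i=\sigma(\#i)$. For an object $X$, let $\coprod_{n\in\mathbf N}X^{I_n}$ be the object of rigid paths in $X$ (the coproduct being taken internally, over the natural numbers object). A rigid path $\sigma\in X^{I_m}$ is an \emph{expansion} of $\theta\in X^{I_n}$ if $\sigma=\theta\circ\delta$ for a degeneracy operator $\delta:I_m\to I_n$, i.e. a map given on points by a monotone surjection $\{0,\dots,m\}\to\{0,\dots,n\}$. The Hurewicz path object $X^{\langle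 I\rangle}$ is the quotient of $\coprod_{n\in\mathbf N}X^{I_n}$ by the (internal) equivalence relation generated by the relation "$\sigma$ is an expansion of $\theta$". It is functorial in $X$ by postcomposition, written $f\mapsto f^{\langle I\rangle}$, and has a natural source map $s_X:X^{\langle I\rangle}\to X$, $[\sigma]\mapsto\sigma_0$. A map $f:X\to Y$ is a \emph{Hurewicz fibration} if the canonical map $$\langle f^{\langle I\rangle},s_X\rangle_Y:\;X^{\langle I\rangle}\longrightarrow Y^{\langle I\rangle}\times_Y X$$ into the pullback of $s_Y$ and $f$ has a section (a \emph{Hurewicz connection}). Let $\mathcal H$ be the class of Hurewicz fibrations. \textbf{Theorem.} $(\mathbb H,\mathcal H)$ is a tribe. That is, $\mathcal H$ is a class of fibrations (it contains all isomorphisms, is closed under composition, and is stable under base change along arbitrary maps), and every object $X$ is fibrant, i.e. the map $X\to\mathbf 1$ is in $\mathcal H$. -/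

import Mathlib

open CategoryTheory Limits MonoidalCategory CartesianMonoidalCategory

universe v u

namespace HTopos

/-- A topos: a finitely complete category in which every functor `Sub (A × -)` is representable. -/
class Topos (C : Type u) [Category.{v} C] [CartesianMonoidalCategory C] : Prop where
  hasFiniteLimits : HasFiniteLimits C
  isRepresentable (A : C) : ((tensorLeft A).op ⋙ Subobject.presheaf C).IsRepresentable

attribute [instance] Topos.hasFiniteLimits

section Topos

noncomputable section

variable {C : Type u} [Category.{v} C] [CartesianMonoidalCategory C]

instance graph_mono {X B : C} (b : X ⟶ B) : Mono (lift b (𝟙 X)) :=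
  ⟨fun f g h => by simpa using congr($h ≫ snd _ _)⟩

/-- The graph of a morphism. -/
def graph {X B : C} (b : X ⟶ B) : Subobject (B ⊗ X) := Subobject.mk (lift b (𝟙 X))

theorem graph_injective {X B : C} {b b' : X ⟶ B} (h : graph b = graph b') : b = b' := by
  have h1 := Subobject.ofMkLEMk_comp h.le
  have h2 := congr($h1 ≫ snd _ _)
  have h3 := congr($h1 ≫ fst _ _)
  simp only [Category.assoc, lift_snd, Category.comp_id, lift_fst] at h2 h3
  rw [← h3, h2, Category.id_comp]

theorem swap_swap (X A : C) : lift (snd X A) (fst X A) ≫ lift (snd A X) (fst A X) = 𝟙 _ := by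
  ext <;> simp

theorem swap_whisker {A X Y : C} (f : X ⟶ Y) :
    lift (snd X A) (fst X A) ≫ A ◁ f = f ▷ A ≫ lift (snd Y A) (fst Y A) := by
  ext <;> simp

theorem swap_whisker' {A X Y : C} (f : X ⟶ Y) :
    lift (snd A X) (fst A X) ≫ f ▷ A = A ◁ f ≫ lift (snd A Y) (fst A Y) := by
  ext <;> simp

variable [Topos C]

/-- The power object `P A`. -/
def pow (A : C) : C := (Topos.isRepresentable A).has_representation.choose

/-- Morphisms `X ⟶ P A` correspond to subobjects of `A ⊗ X`. -/
def rel {A X : C} : (X ⟶ pow A) ≃ Subobject (A ⊗ X) :=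
  (Topos.isRepresentable A).has_representation.choose_spec.some.homEquiv

theorem rel_comp {A X Y : C} (f : X ⟶ Y) (g : Y ⟶ pow A) :
    rel (f ≫ g) = (Subobject.pullback (A ◁ f)).obj (rel g) :=
  (Topos.isRepresentable A).has_representation.choose_spec.some.homEquiv_comp f g

theorem comp_rel_symm {A X Y : C} (f : X ⟶ Y) (S : Subobject (A ⊗ Y)) :
    f ≫ rel.symm S = rel.symm ((Subobject.pullback (A ◁ f)).obj S) := by
  apply rel.injective
  rw [rel_comp]; simp

theorem pullback_graph {X Y B : C} (f : X ⟶ Y) (b : Y ⟶ B) :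
    (Subobject.pullback (B ◁ f)).obj (graph b) = graph (f ≫ b) := by
  refine (Subobject.pullback_obj_mk (f' := f) ?_).trans rfl
  refine ⟨⟨by ext <;> simp⟩, ⟨PullbackCone.IsLimit.mk _ (fun s => s.snd ≫ snd _ _) ?_ ?_ ?_⟩⟩
  · intro s
    have h2 := congr($(s.condition) ≫ snd _ _)
    simpa using h2.symm
  · intro s
    have h1 := congr($(s.condition) ≫ fst _ _)
    have h2 := congr($(s.condition) ≫ snd _ _)
    simp at h1 h2
    ext
    · simp [h1, ← reassoc_of% h2]
    · simp
  · intro s m h1 h2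
    simpa using congr($h2 ≫ snd _ _)

/-- The singleton map `B ⟶ P B`. -/
def singleton (B : C) : B ⟶ pow B := rel.symm (graph (𝟙 B))

theorem comp_singleton {X B : C} (b : X ⟶ B) : b ≫ singleton B = rel.symm (graph b) := by
  rw [singleton, comp_rel_symm, pullback_graph, Category.comp_id]

instance (B : C) : Mono (singleton B) :=
  ⟨fun f g h => graph_injective (rel.symm.injective (by rwa [comp_singleton, comp_singleton] at h))⟩

/-- Morphisms `A ⊗ X ⟶ P B` correspond to morphisms `X ⟶ P (B ⊗ A)`. -/
def powCurry {A B X : C} : (X ⟶ pow (B ⊗ A)) ≃ (A ⊗ X ⟶ pow B) where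
  toFun x := rel.symm ((Subobject.pullback (α_ B A X).inv).obj (rel x))
  invFun y := rel.symm ((Subobject.pullback (α_ B A X).hom).obj (rel y))
  left_inv x := by simp [← Subobject.pullback_comp, Subobject.pullback_id]
  right_inv y := by simp [← Subobject.pullback_comp, Subobject.pullback_id]

theorem powCurry_comp {A B X Y : C} (f : X ⟶ Y) (g : Y ⟶ pow (B ⊗ A)) :
    powCurry (f ≫ g) = A ◁ f ≫ powCurry g := by
  simp only [powCurry, Equiv.coe_fn_mk, comp_rel_symm, rel_comp, ← Subobject.pullback_comp]
  congr 3
  simp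

/-- The truth value "`x` takes values in singletons" on `P (B ⊗ A)`. -/
def isFun (A B : C) : pow (B ⊗ A) ⟶ pow A :=
  rel.symm ((Subobject.pullback (powCurry (𝟙 (pow (B ⊗ A))))).obj (Subobject.mk (singleton B)))

theorem comp_isFun_iff {A B X : C} (x : X ⟶ pow (B ⊗ A)) :
    x ≫ isFun A B = x ≫ rel.symm ⊤ ↔ ∃ b : A ⊗ X ⟶ B, b ≫ singleton B = powCurry x := by
  rw [isFun, comp_rel_symm, comp_rel_symm, rel.symm.injective.eq_iff, Subobject.pullback_top,
    ← Subobject.pullback_comp, ← powCurry_comp, Category.comp_id]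
  constructor
  · intro h
    have h1 : ((Subobject.pullback (powCurry x)).obj (Subobject.mk (singleton B))).Factors
        (𝟙 _) := by rw [h]; exact Subobject.top_factors _
    rw [Limits.pullback_factors_iff, Subobject.mk_factors_iff] at h1
    obtain ⟨b, hb⟩ := h1
    exact ⟨b, by simpa using hb⟩
  · rintro ⟨b, hb⟩
    rw [← hb, Subobject.pullback_comp, Subobject.pullback_self, Subobject.pullback_top]

/-- The exponential `B ^ A`: the functional relations from `A` to `B`. -/
def expObj (A B : C) : C := equalizer (isFun A B) (rel.symm ⊤)

/-- The inclusion of the functional relations into all relations. -/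
def expι (A B : C) : expObj A B ⟶ pow (B ⊗ A) := equalizer.ι _ _

theorem expι_condition (A B : C) : expι A B ≫ isFun A B = expι A B ≫ rel.symm ⊤ :=
  equalizer.condition _ _

instance (A B : C) : Mono (expι A B) := inferInstanceAs (Mono (equalizer.ι _ _))

theorem exists_uncurry {A B X : C} (f : X ⟶ expObj A B) :
    ∃ b : A ⊗ X ⟶ B, b ≫ singleton B = powCurry (f ≫ expι A B) :=
  (comp_isFun_iff _).1 (by rw [Category.assoc, expι_condition, Category.assoc])

/-- The transpose of a morphism `A ⊗ X ⟶ B`. -/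
def expCurry {A X B : C} (b : A ⊗ X ⟶ B) : X ⟶ expObj A B :=
  equalizer.lift (powCurry.symm (b ≫ singleton B)) ((comp_isFun_iff _).2 ⟨b, by simp⟩)

theorem expCurry_ι {A X B : C} (b : A ⊗ X ⟶ B) :
    expCurry b ≫ expι A B = powCurry.symm (b ≫ singleton B) :=
  equalizer.lift_ι _ _

/-- The exponential adjunction. -/
def expEquiv (A X B : C) : (A ⊗ X ⟶ B) ≃ (X ⟶ expObj A B) where
  toFun b := expCurry b
  invFun f := (exists_uncurry f).choose
  left_inv b := by
    rw [← cancel_mono (singleton B), (exists_uncurry (expCurry b)).choose_spec, expCurry_ι,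
      Equiv.apply_symm_apply]
  right_inv f := by
    rw [← cancel_mono (expι A B), expCurry_ι, (exists_uncurry f).choose_spec,
      Equiv.symm_apply_apply]

theorem expEquiv_natural {A X' X B : C} (f : X' ⟶ X) (g : A ⊗ X ⟶ B) :
    expEquiv A X' B (A ◁ f ≫ g) = f ≫ expEquiv A X B g := by
  rw [← cancel_mono (expι A B), ← powCurry.injective.eq_iff, Category.assoc]
  have h {Z : C} (b : A ⊗ Z ⟶ B) : powCurry (expEquiv A Z B b ≫ expι A B) = b ≫ singleton B :=
    (congrArg powCurry (expCurry_ι b)).trans (Equiv.apply_symm_apply _ _)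
  rw [h, powCurry_comp, h, Category.assoc]

/-- The exponential adjunction. -/
def expAdj (A : C) := Adjunction.adjunctionOfEquivRight (F := tensorLeft A) (G_obj := expObj A)
  (expEquiv A) (fun _ _ _ f g => expEquiv_natural f g)

/-- A topos is cartesian closed. -/
instance : MonoidalClosed C where
  closed A := { rightAdj := _, adj := expAdj A }

/-- A topos has a subobject classifier. -/
instance : HasSubobjectClassifier C := by
  rw [hasSubobjectClassifier_iff_isRepresentable]
  refine ⟨pow (𝟙_ C), ⟨⟨rel.trans ⟨(Subobject.pullback (λ_ _).inv).obj,
    (Subobject.pullback (λ_ _).hom).obj, fun x => ?_, fun x => ?_⟩, ?_⟩⟩⟩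
  · simp [← Subobject.pullback_comp, Subobject.pullback_id]
  · refine (Subobject.pullback_comp _ _ _).symm.trans ?_
    rw [Iso.inv_hom_id]
    exact Subobject.pullback_id _
  · intro X X' f g
    change (Subobject.pullback _).obj (rel (f ≫ g)) =
      (Subobject.pullback f).obj ((Subobject.pullback _).obj (rel g))
    rw [rel_comp, ← Subobject.pullback_comp, ← Subobject.pullback_comp]
    simp

/-- The contravariant action of the power object on morphisms, by inverse image. -/
def powMap {A B : C} (f : A ⟶ B) : pow B ⟶ pow A :=
  rel.symm ((Subobject.pullback (f ▷ pow B)).obj (rel (𝟙 _)))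

theorem rel_comp_powMap {A B X : C} (f : A ⟶ B) (x : X ⟶ pow B) :
    rel (x ≫ powMap f) = (Subobject.pullback (f ▷ X)).obj (rel x) := by
  conv_rhs => rw [← Category.comp_id x]
  simp only [powMap, rel_comp, Equiv.apply_symm_apply, ← Subobject.pullback_comp]
  simp [whisker_exchange]

theorem powMap_id (A : C) : powMap (𝟙 A) = 𝟙 (pow A) := by
  apply rel.injective
  conv_lhs => rw [← Category.id_comp (powMap _)]
  rw [rel_comp_powMap]
  simp [Subobject.pullback_id]

theorem powMap_comp {A B D : C} (f : A ⟶ B) (g : B ⟶ D) :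
    powMap (f ≫ g) = powMap g ≫ powMap f := by
  apply rel.injective
  conv_lhs => rw [← Category.id_comp (powMap _)]
  conv_rhs => rw [← Category.id_comp (powMap _), Category.assoc]
  rw [← Category.assoc, rel_comp_powMap, rel_comp_powMap, rel_comp_powMap, ← Subobject.pullback_comp,
    comp_whiskerRight]

theorem powMap_injective {A B : C} {f g : A ⟶ B} (h : powMap f = powMap g) : f = g := by
  have h1 : rel (singleton B ≫ powMap f) = rel (singleton B ≫ powMap g) := by rw [h]
  rw [rel_comp_powMap, rel_comp_powMap, singleton, Equiv.apply_symm_apply] at h1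
  have h2 : ((Subobject.pullback (f ▷ B)).obj (graph (𝟙 B))).Factors (lift (𝟙 A) f) := by
    rw [Limits.pullback_factors_iff, graph, Subobject.mk_factors_iff]
    exact ⟨f, by ext <;> simp⟩
  rw [h1, Limits.pullback_factors_iff, graph, Subobject.mk_factors_iff] at h2
  obtain ⟨k, hk⟩ := h2
  have key (k : A ⟶ B) (hk : k ≫ lift (𝟙 B) (𝟙 B) = lift (𝟙 A) f ≫ g ▷ B) : f = g := by
    have h3 := congr($hk ≫ fst _ _)
    have h4 := congr($hk ≫ snd _ _)
    simp at h3 h4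
    rw [← h4, h3]
  exact key k hk

instance whiskerRight_mono {A B : C} (m : A ⟶ B) [Mono m] (X : C) : Mono (m ▷ X) :=
  ⟨fun f g h => by
    have h1 := congr($h ≫ fst _ _)
    have h2 := congr($h ≫ snd _ _)
    simp only [Category.assoc, whiskerRight_fst, whiskerRight_snd] at h1 h2
    ext
    · rw [← cancel_mono m]; simpa using h1
    · exact h2⟩

/-- Direct image along a monomorphism. -/
def powEx {A B : C} (m : A ⟶ B) [Mono m] : pow A ⟶ pow B :=
  rel.symm ((Subobject.map (m ▷ pow A)).obj (rel (𝟙 _)))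

theorem rel_comp_powEx {A B X : C} (m : A ⟶ B) [Mono m] (x : X ⟶ pow A) :
    rel (x ≫ powEx m) = (Subobject.map (m ▷ X)).obj (rel x) := by
  conv_rhs => rw [← Category.comp_id x]
  rw [powEx, rel_comp, rel_comp, Equiv.apply_symm_apply]
  refine (Subobject.map_pullback (whisker_exchange m x) ?_ _).symm
  refine PullbackCone.IsLimit.mk _ (fun s => lift (s.fst ≫ fst _ _) (s.snd ≫ snd _ _)) ?_ ?_ ?_
  · intro s
    have h2 := congr($(s.condition) ≫ snd _ _)
    simp at h2
    ext <;> simp [h2]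
  · intro s
    have h1 := congr($(s.condition) ≫ fst _ _)
    simp at h1
    ext <;> simp [h1]
  · intro s m h1 h2
    ext
    · simpa using congr($h1 ≫ fst _ _)
    · simpa using congr($h2 ≫ snd _ _)

/-- The Beck-Chevalley condition. -/
theorem powEx_powMap {W Y Z V : C} {a : W ⟶ Y} {b : W ⟶ Z} {m : Y ⟶ V} {k : Z ⟶ V}
    [Mono m] [Mono b] (h : IsPullback a b m k) : powEx m ≫ powMap k = powMap a ≫ powEx b := by
  apply rel.injective
  conv_lhs => rw [← Category.id_comp (powEx m), Category.assoc, ← Category.assoc]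
  conv_rhs => rw [← Category.id_comp (powMap a), Category.assoc, ← Category.assoc]
  rw [rel_comp_powMap, rel_comp_powEx, rel_comp_powEx, rel_comp_powMap]
  have comm : a ▷ pow Y ≫ m ▷ pow Y = b ▷ pow Y ≫ k ▷ pow Y := by
    rw [← comp_whiskerRight, ← comp_whiskerRight, h.w]
  refine (Subobject.map_pullback comm ?_ _).symm
  have hs (s : PullbackCone (m ▷ pow Y) (k ▷ pow Y)) :
      (s.fst ≫ fst _ _) ≫ m = (s.snd ≫ fst _ _) ≫ k := by
    simpa using congr($(s.condition) ≫ fst _ _)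
  refine PullbackCone.IsLimit.mk _
    (fun s => lift (h.lift (s.fst ≫ fst _ _) (s.snd ≫ fst _ _) (hs s)) (s.fst ≫ snd _ _)) ?_ ?_ ?_
  · intro s
    ext <;> simp
  · intro s
    have h1 := congr($(s.condition) ≫ snd _ _)
    simp at h1
    ext <;> simp [h1]
  · intro s t h1 h2
    ext
    · apply h.hom_ext
      · simpa using congr($h1 ≫ fst _ _)
      · simpa using congr($h2 ≫ fst _ _)
    · simpa using congr($h1 ≫ snd _ _)

theorem powEx_powMap_self {A B : C} (m : A ⟶ B) [Mono m] : powEx m ≫ powMap m = 𝟙 _ := by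
  apply rel.injective
  conv_lhs => rw [← Category.id_comp (powEx m), Category.assoc, ← Category.assoc]
  rw [rel_comp_powMap, rel_comp_powEx, Subobject.pullback_map_self]

variable (C) in
/-- The power object functor. -/
def powFunctor : Cᵒᵖ ⥤ C where
  obj A := pow A.unop
  map f := powMap f.unop
  map_id A := powMap_id A.unop
  map_comp f g := powMap_comp g.unop f.unop

instance : (powFunctor C).Faithful where
  map_injective h := Quiver.Hom.unop_inj (powMap_injective h)

/-- Transposition of relations. -/
def powTranspose {A X : C} : (A ⟶ pow X) ≃ (X ⟶ pow A) where
  toFun x := rel.symm ((Subobject.pullback (lift (snd _ _) (fst _ _))).obj (rel x))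
  invFun x := rel.symm ((Subobject.pullback (lift (snd _ _) (fst _ _))).obj (rel x))
  left_inv x := by simp [← Subobject.pullback_comp, Subobject.pullback_id]
  right_inv x := by simp [← Subobject.pullback_comp, Subobject.pullback_id]

theorem powTranspose_comp {A X Y : C} (f : X ⟶ Y) (x : A ⟶ pow Y) :
    powTranspose (x ≫ powMap f) = f ≫ powTranspose x := by
  simp only [powTranspose, Equiv.coe_fn_mk]
  rw [comp_rel_symm, rel_comp_powMap, ← Subobject.pullback_comp, ← Subobject.pullback_comp,
    swap_whisker']

theorem comp_powTranspose {A B X : C} (f : B ⟶ A) (x : A ⟶ pow X) :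
    powTranspose (f ≫ x) = powTranspose x ≫ powMap f := by
  apply rel.injective
  rw [rel_comp_powMap]
  simp only [powTranspose, Equiv.coe_fn_mk, Equiv.apply_symm_apply]
  rw [rel_comp, ← Subobject.pullback_comp, ← Subobject.pullback_comp, swap_whisker]

/-- The power object functor has a left adjoint. -/
def powAdj := Adjunction.adjunctionOfEquivLeft (G := powFunctor C)
    (F_obj := fun X => Opposite.op (pow X))
    (fun _ A => (opEquiv _ A).trans powTranspose)
    (fun _ _ _ g h => comp_powTranspose g.unop h.unop)

/-- The power object functor preserves reflexive coequalizers. -/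
instance : Monad.PreservesColimitOfIsReflexivePair (powFunctor C) where
  out X Y f g _ := by
    obtain ⟨s, hf, hg⟩ := IsReflexivePair.common_section' (f := f) (g := g)
    have hf' : f.unop ≫ s.unop = 𝟙 _ := congr(($hf).unop)
    have hg' : g.unop ≫ s.unop = 𝟙 _ := congr(($hg).unop)
    have : Mono f.unop := (SplitMono.mk s.unop hf').mono
    have : Mono g.unop := (SplitMono.mk s.unop hg').mono
    let m := equalizer.ι f.unop g.unop
    have hm : m ≫ f.unop = m ≫ g.unop := equalizer.condition _ _
    have hm' : f ≫ m.op = g ≫ m.op := Quiver.Hom.unop_inj hm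
    have sq : IsPullback m m g.unop f.unop := by
      have e (t : PullbackCone g.unop f.unop) : t.fst = t.snd := by
        have := congr($(t.condition) ≫ s.unop)
        simpa [hf', hg'] using this
      refine ⟨⟨hm.symm⟩, ⟨PullbackCone.IsLimit.mk _
        (fun t => equalizer.lift t.fst (by rw [t.condition, ← e])) ?_ ?_ ?_⟩⟩
      · intro t; simp [m]
      · intro t; simp [m, e]
      · intro t l h1 _
        apply equalizer.hom_ext
        simpa [m] using h1
    have hc : IsColimit (Cofork.ofπ m.op hm') :=
      Cofork.IsColimit.mk' _ fun t =>
        ⟨(equalizer.lift t.π.unop congr(($(t.condition)).unop)).op,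
          Quiver.Hom.unop_inj (equalizer.lift_ι _ _), fun {l} hl =>
          Quiver.Hom.unop_inj (equalizer.hom_ext (by
            have := congr(($hl).unop)
            simpa [m] using this))⟩
    refine preservesColimit_of_preserves_colimit_cocone hc
      ((isColimitMapCoconeCoforkEquiv (powFunctor C) hm').symm ?_)
    exact IsSplitCoequalizer.isCoequalizer
      { rightSection := powEx m
        leftSection := powEx g.unop
        condition := by
          rw [← powMap_comp, ← powMap_comp, hm]
        rightSection_π := powEx_powMap_self m
        leftSection_bottom := powEx_powMap_self g.unop
        leftSection_top := powEx_powMap sq }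

/-- A topos is finitely cocomplete. -/
instance : HasFiniteColimits C := by
  have := Monad.monadicOfHasPreservesReflexiveCoequalizersOfReflectsIsomorphisms (powAdj (C := C))
  rw [← hasFiniteLimits_opposite_iff]
  exact ⟨fun J _ _ => ⟨fun F =>
    have := monadicCreatesLimits.{0, 0} (powFunctor C)
    hasLimit_of_created F (powFunctor C)⟩⟩

end

end Topos

section Hurewicz

open MonoidalClosed
open scoped CartesianClosed

/-- A natural numbers object. -/
structure NNO (C : Type u) [Category.{v} C] [CartesianMonoidalCategory C] where
  /-- The object of natural numbers. -/
  N : C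
  /-- Zero. -/
  zero : 𝟙_ C ⟶ N
  /-- The successor. -/
  succ : N ⟶ N
  existsUnique_rec {X : C} (a : 𝟙_ C ⟶ X) (f : X ⟶ X) :
    ∃! h : N ⟶ X, zero ≫ h = a ∧ succ ≫ h = h ≫ f

noncomputable section

/-- `2 = 1 + 1`. -/
def two (C : Type u) [Category.{v} C] [CartesianMonoidalCategory C] [Topos C] : C :=
  𝟙_ C ⨿ 𝟙_ C

/-- `X` is connected if `2 ^ X ≅ 2`. -/
def IsConnectedObject {C : Type u} [Category.{v} C] [CartesianMonoidalCategory C] [Topos C]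
    (X : C) : Prop :=
  Nonempty ((X ⟹ two C) ≅ two C)

/-- An elementary interval: a connected object with precisely two distinct global elements,
such that every morphism out of it is determined by its values at these two. -/
structure ElementaryInterval (C : Type u) [Category.{v} C] [CartesianMonoidalCategory C]
    [Topos C] where
  /-- The underlying object. -/
  I : C
  isConnected : IsConnectedObject I
  /-- The start point `#0`. -/
  pt0 : 𝟙_ C ⟶ I
  /-- The end point `#1`. -/
  pt1 : 𝟙_ C ⟶ I
  pt0_ne_pt1 : pt0 ≠ pt1
  eq_pt0_or_eq_pt1 (p : 𝟙_ C ⟶ I) : p = pt0 ∨ p = pt1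
  hom_ext {X : C} (f g : I ⟶ X) : pt0 ≫ f = pt0 ≫ g → pt1 ≫ f = pt1 ≫ g → f = g

/-- A Hurewicz topos: a topos with a natural numbers object and a distinguished elementary
interval. -/
class HurewiczTopos (C : Type u) [Category.{v} C] [CartesianMonoidalCategory C]
    extends Topos C where
  /-- The natural numbers object. -/
  nno : NNO C
  /-- The distinguished elementary interval. -/
  interval : ElementaryInterval C

variable (C : Type u) [Category.{v} C] [CartesianMonoidalCategory C] [HurewiczTopos C]

/-- The natural numbers object of a Hurewicz topos. -/
def nat : C := (HurewiczTopos.nno (C := C)).N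

/-- Zero. -/
def zero : 𝟙_ C ⟶ nat C := (HurewiczTopos.nno (C := C)).zero

/-- The successor. -/
def succ : nat C ⟶ nat C := (HurewiczTopos.nno (C := C)).succ

/-- The distinguished elementary interval of a Hurewicz topos. -/
def ival : C := (HurewiczTopos.interval (C := C)).I

/-- The start point of the interval. -/
def pt0 : 𝟙_ C ⟶ ival C := (HurewiczTopos.interval (C := C)).pt0

/-- The end point of the interval. -/
def pt1 : 𝟙_ C ⟶ ival C := (HurewiczTopos.interval (C := C)).pt1

variable {C}

/-- The morphism out of the natural numbers object defined by recursion. -/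
def natRec {X : C} (a : 𝟙_ C ⟶ X) (f : X ⟶ X) : nat C ⟶ X :=
  (HurewiczTopos.nno.existsUnique_rec a f).choose

variable (C) in
/-- Addition `(a, k) ↦ a + k`, by recursion on `k`: `a + 0 = a` and `a + (k + 1) = (a + k) + 1`. -/
def add : nat C ⊗ nat C ⟶ nat C :=
  uncurry (natRec (X := nat C ⟹ nat C) (curry (fst _ _)) ((ihom (nat C)).map (succ C)))

variable (C) in
/-- The inclusion of `2` into the natural numbers as `{0, 1}`. -/
def bit : two C ⟶ nat C := coprod.desc (zero C) (zero C ≫ succ C)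

/-- The value `s (a)` of a generalized element `s` of an exponential at a generalized element. -/
def app {T A Y : C} (s : T ⟶ A ⟹ Y) (a : T ⟶ A) : T ⟶ Y := lift a s ≫ (ihom.ev A).app Y

/-- Evaluation `X ^ I ⟶ X` at a point of the interval. -/
def evalAt (p : 𝟙_ C ⟶ ival C) (X : C) : (ival C ⟹ X) ⟶ X := app (𝟙 _) (toUnit _ ≫ p)

section lemmas

theorem comp_app {S T A Y : C} (f : S ⟶ T) (s : T ⟶ A ⟹ Y) (a : T ⟶ A) :
    f ≫ app s a = app (f ≫ s) (f ≫ a) := by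
  simp [app, comp_lift_assoc]

theorem comp_app_assoc {S T A Y Z : C} (f : S ⟶ T) (s : T ⟶ A ⟹ Y) (a : T ⟶ A) (g : Y ⟶ Z) :
    f ≫ app s a ≫ g = app (f ≫ s) (f ≫ a) ≫ g := by
  rw [← comp_app, Category.assoc]

theorem app_map {T A Y Z : C} (s : T ⟶ A ⟹ Y) (a : T ⟶ A) (g : Y ⟶ Z) :
    app (s ≫ (ihom A).map g) a = app s a ≫ g := by
  have h : lift a (s ≫ (ihom A).map g) = lift a s ≫ A ◁ (ihom A).map g := by ext <;> simp
  rw [app, app, h, Category.assoc, Category.assoc]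
  congr 1
  exact (ihom.ev A).naturality g

theorem app_map_assoc {T A Y Z W : C} (s : T ⟶ A ⟹ Y) (a : T ⟶ A) (g : Y ⟶ Z) (g' : Z ⟶ W) :
    app (s ≫ (ihom A).map g) a ≫ g' = app s a ≫ g ≫ g' := by
  rw [app_map, Category.assoc]

theorem map_evalAt (p : 𝟙_ C ⟶ ival C) {X Y : C} (f : X ⟶ Y) :
    (ihom (ival C)).map f ≫ evalAt p Y = evalAt p X ≫ f := by
  rw [evalAt, evalAt, comp_app, Category.comp_id, ← app_map, Category.id_comp]
  congr 1
  simp [← Category.assoc]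

theorem app_curry {T G A Y : C} (g : T ⟶ G) (k : T ⟶ A) (a : A ⊗ G ⟶ Y) :
    app (g ≫ curry a) k = lift k g ≫ a := by
  have h : lift k (g ≫ curry a) = lift k g ≫ A ◁ curry a := by ext <;> simp
  rw [app, h, Category.assoc]
  congr 1
  exact uncurry_curry a

end lemmas

/-! ### Rigid paths

Since `I_0 = 1` and `I_{n+1}` is the pushout of `I_n` and `I` that glues the last point of `I_n` to
the point `#0` of `I`, the object `X ^ I_n` consists of the composable chains of `n` elements of
`X ^ I` (of the points of `X` if `n = 0`). Such a chain is extended to all natural numbers by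
constant elements of `X ^ I`. So the coproduct of all `X ^ I_n`, with `n` in the natural numbers
object, is the object of pairs `(n, γ)` of a natural number and a sequence in `X ^ I` such that, for
all `k`, `γ_k (#1) = γ_{k+1} (#0)` and `γ_{n+k} (#0) = γ_n (#0)`; as an element of `X ^ I` is
determined by its values at `#0` and `#1`, the second equation says that `γ` is constant from `n` on.
The vertices of the path are `γ_0 (#0), ..., γ_n (#0)`. -/

section rigid

variable (X : C)

/-- The object of all `(n, γ)` with `n` a natural number and `γ` a sequence in `X ^ I`. -/
abbrev PreRigid : C := nat C ⊗ (nat C ⟹ (ival C ⟹ X))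

variable {X} in
/-- The number `n` of `(n, γ)`. -/
def PreRigid.len {T : C} (e : T ⟶ PreRigid X) : T ⟶ nat C := e ≫ fst _ _

variable {X} in
/-- The sequence `γ` of `(n, γ)`. -/
def PreRigid.steps {T : C} (e : T ⟶ PreRigid X) : T ⟶ nat C ⟹ (ival C ⟹ X) := e ≫ snd _ _

open PreRigid

/-- The left hand sides of the two equations, for all `k`. -/
def rigidLHS : PreRigid X ⟶ nat C ⟹ (X ⊗ X) :=
  curry
    (let k : nat C ⊗ PreRigid X ⟶ nat C := fst _ _
     let e : nat C ⊗ PreRigid X ⟶ PreRigid X := snd _ _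
     lift (app (steps e) k ≫ evalAt (pt1 C) X)
      (app (steps e) (lift (len e) k ≫ add C) ≫ evalAt (pt0 C) X))

/-- The right hand sides of the two equations, for all `k`. -/
def rigidRHS : PreRigid X ⟶ nat C ⟹ (X ⊗ X) :=
  curry
    (let k : nat C ⊗ PreRigid X ⟶ nat C := fst _ _
     let e : nat C ⊗ PreRigid X ⟶ PreRigid X := snd _ _
     lift (app (steps e) (k ≫ succ C) ≫ evalAt (pt0 C) X)
      (app (steps e) (len e) ≫ evalAt (pt0 C) X))

/-- The object of rigid paths of all lengths in `X`, the coproduct of the objects `X ^ I_n`. -/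
def Rigid : C := equalizer (rigidLHS X) (rigidRHS X)

variable {X}

/-- The inclusion of the rigid paths. -/
def Rigid.ι : Rigid X ⟶ PreRigid X := equalizer.ι _ _

theorem Rigid.condition : Rigid.ι ≫ rigidLHS X = Rigid.ι ≫ rigidRHS X := equalizer.condition _ _

/-- The length of a rigid path. -/
def Rigid.len : Rigid X ⟶ nat C := PreRigid.len ι

/-- The sequence of the steps of a rigid path. -/
def Rigid.steps : Rigid X ⟶ nat C ⟹ (ival C ⟹ X) := PreRigid.steps ι

/-- The vertex `σ_k` of a rigid path. -/
def Rigid.vertex {T : C} (σ : T ⟶ Rigid X) (k : T ⟶ nat C) : T ⟶ X :=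
  app (σ ≫ Rigid.steps) k ≫ evalAt (pt0 C) X

theorem Rigid.comp_vertex {S T : C} (f : S ⟶ T) (σ : T ⟶ Rigid X) (k : T ⟶ nat C) :
    f ≫ vertex σ k = vertex (f ≫ σ) (f ≫ k) := by
  simp [vertex, ← comp_app]

/-- The action of a morphism on pairs `(n, γ)`. -/
def PreRigid.map {X Y : C} (f : X ⟶ Y) : PreRigid X ⟶ PreRigid Y :=
  lift (len (𝟙 _)) (steps (𝟙 _) ≫ (ihom (nat C)).map ((ihom (ival C)).map f))

theorem PreRigid.comp_len {S T : C} (g : S ⟶ T) (e : T ⟶ PreRigid X) :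
    g ≫ len e = len (g ≫ e) := by simp [len]

theorem PreRigid.comp_steps {S T : C} (g : S ⟶ T) (e : T ⟶ PreRigid X) :
    g ≫ steps e = steps (g ≫ e) := by simp [steps]

theorem PreRigid.len_map {X Y T : C} (f : X ⟶ Y) (e : T ⟶ PreRigid X) :
    len (e ≫ map f) = len e := by simp [len, map]

theorem PreRigid.steps_map {X Y T : C} (f : X ⟶ Y) (e : T ⟶ PreRigid X) :
    steps (e ≫ map f) = steps e ≫ (ihom (nat C)).map ((ihom (ival C)).map f) := by
  simp [steps, map]

theorem map_rigidLHS {X Y : C} (f : X ⟶ Y) :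
    PreRigid.map f ≫ rigidLHS Y = rigidLHS X ≫ (ihom (nat C)).map (f ⊗ₘ f) := by
  rw [rigidLHS, rigidLHS, ← curry_natural_left, ← curry_natural_right]
  congr 1
  simp only [comp_lift, comp_app_assoc, comp_lift_assoc, comp_steps, comp_len,
    whiskerLeft_fst, whiskerLeft_snd, steps_map, len_map, app_map_assoc, map_evalAt, lift_map,
    Category.assoc]

theorem map_rigidRHS {X Y : C} (f : X ⟶ Y) :
    PreRigid.map f ≫ rigidRHS Y = rigidRHS X ≫ (ihom (nat C)).map (f ⊗ₘ f) := by
  rw [rigidRHS, rigidRHS, ← curry_natural_left, ← curry_natural_right]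
  congr 1
  simp only [comp_lift, comp_app_assoc, comp_steps, comp_len, whiskerLeft_fst_assoc,
    whiskerLeft_snd, steps_map, len_map, app_map_assoc, map_evalAt, lift_map, Category.assoc]

/-- The action of a morphism on rigid paths, by postcomposition. -/
def Rigid.map {X Y : C} (f : X ⟶ Y) : Rigid X ⟶ Rigid Y :=
  equalizer.lift (ι ≫ PreRigid.map f) (by
    rw [Category.assoc, Category.assoc, map_rigidLHS, map_rigidRHS, ← Category.assoc,
      condition, Category.assoc])

theorem Rigid.map_ι {X Y : C} (f : X ⟶ Y) : Rigid.map f ≫ ι = ι ≫ PreRigid.map f :=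
  equalizer.lift_ι _ _

theorem Rigid.map_len {X Y : C} (f : X ⟶ Y) : Rigid.map f ≫ Rigid.len = Rigid.len := by
  rw [Rigid.len, Rigid.len, comp_len, map_ι, len_map]

theorem Rigid.map_steps {X Y : C} (f : X ⟶ Y) :
    Rigid.map f ≫ Rigid.steps = Rigid.steps ≫ (ihom (nat C)).map ((ihom (ival C)).map f) := by
  rw [Rigid.steps, Rigid.steps, comp_steps, map_ι, steps_map]

theorem Rigid.vertex_map {X Y T : C} (f : X ⟶ Y) (σ : T ⟶ Rigid X) (k : T ⟶ nat C) :
    vertex (σ ≫ Rigid.map f) k = vertex σ k ≫ f := by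
  rw [vertex, vertex, Category.assoc, Rigid.map_steps, ← Category.assoc, app_map, Category.assoc,
    Category.assoc, map_evalAt]

end rigid

/-! ### Expansions

A degeneracy operator `I_m ⟶ I_n` amounts to a monotone surjection from `{0, ..., m}` onto
`{0, ..., n}`, i.e. to a sequence `d` with `d 0 = 0`, `d m = n` and `d (k + 1) - d k ∈ {0, 1}`, of
which only the values up to `m` matter. Since a morphism out of `I` is determined by its values at
the end points, a rigid path is determined by its vertices, and `σ` (of length `m`) is the
expansion along `d` of `θ` (of length `n`) if and only if `σ_k = θ_{d k}` for all `k`. -/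

section expansion

variable (X : C)

/-- The object of all `(σ, θ, d, b)` with `σ` and `θ` rigid paths in `X`, `d` a sequence of natural
numbers and `b` a sequence in `2`. -/
abbrev PreExpansion : C := Rigid X ⊗ (Rigid X ⊗ ((nat C ⟹ nat C) ⊗ (nat C ⟹ two C)))

variable {X} in
/-- The path `σ` of `(σ, θ, d, b)`. -/
def PreExpansion.σ {T : C} (e : T ⟶ PreExpansion X) : T ⟶ Rigid X := e ≫ fst _ _

variable {X} in
/-- The path `θ` of `(σ, θ, d, b)`. -/
def PreExpansion.θ {T : C} (e : T ⟶ PreExpansion X) : T ⟶ Rigid X := e ≫ snd _ _ ≫ fst _ _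

variable {X} in
/-- The sequence `d` of `(σ, θ, d, b)`. -/
def PreExpansion.d {T : C} (e : T ⟶ PreExpansion X) : T ⟶ nat C ⟹ nat C :=
  e ≫ snd _ _ ≫ snd _ _ ≫ fst _ _

variable {X} in
/-- The sequence `b` of `(σ, θ, d, b)`. -/
def PreExpansion.b {T : C} (e : T ⟶ PreExpansion X) : T ⟶ nat C ⟹ two C :=
  e ≫ snd _ _ ≫ snd _ _ ≫ snd _ _

open PreExpansion

/-- The left hand sides of the equations `d 0 = 0`, `d (length σ) = length θ` and, for all `k`,
`d (k + 1) = d k + b k`, `σ_k = θ_{d k}`. -/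
def expansionLHS : PreExpansion X ⟶ (nat C ⊗ nat C) ⊗ (nat C ⟹ (nat C ⊗ X)) :=
  lift
    (let e : PreExpansion X ⟶ PreExpansion X := 𝟙 _
     lift (app (d e) (toUnit _ ≫ zero C)) (app (d e) (σ e ≫ Rigid.len)))
    (curry
      (let k : nat C ⊗ PreExpansion X ⟶ nat C := fst _ _
       let e : nat C ⊗ PreExpansion X ⟶ PreExpansion X := snd _ _
       lift (app (d e) (k ≫ succ C)) (Rigid.vertex (σ e) k)))

/-- The right hand sides of these equations. -/
def expansionRHS : PreExpansion X ⟶ (nat C ⊗ nat C) ⊗ (nat C ⟹ (nat C ⊗ X)) :=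
  lift
    (let e : PreExpansion X ⟶ PreExpansion X := 𝟙 _
     lift (toUnit _ ≫ zero C) (θ e ≫ Rigid.len))
    (curry
      (let k : nat C ⊗ PreExpansion X ⟶ nat C := fst _ _
       let e : nat C ⊗ PreExpansion X ⟶ PreExpansion X := snd _ _
       lift (lift (app (d e) k) (app (b e) k ≫ bit C) ≫ add C) (Rigid.vertex (θ e) (app (d e) k))))

/-- The object of all `(σ, θ, d, b)` such that `σ` is the expansion of `θ` along the degeneracy
operator `d`. -/
def Expansion : C := equalizer (expansionLHS X) (expansionRHS X)

variable {X}

/-- The inclusion of expansions. -/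
def Expansion.ι : Expansion X ⟶ PreExpansion X := equalizer.ι _ _

theorem Expansion.condition : Expansion.ι ≫ expansionLHS X = Expansion.ι ≫ expansionRHS X :=
  equalizer.condition _ _

/-- The expansion `σ` of `θ`. -/
def Expansion.left : Expansion X ⟶ Rigid X := σ ι

/-- The path `θ` that is expanded. -/
def Expansion.right : Expansion X ⟶ Rigid X := θ ι

/-- The action of a morphism on quadruples `(σ, θ, d, b)`. -/
def PreExpansion.map {X Y : C} (f : X ⟶ Y) : PreExpansion X ⟶ PreExpansion Y :=
  lift (σ (𝟙 _) ≫ Rigid.map f) (lift (θ (𝟙 _) ≫ Rigid.map f) (lift (d (𝟙 _)) (b (𝟙 _))))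

theorem PreExpansion.comp_σ {S T : C} (g : S ⟶ T) (e : T ⟶ PreExpansion X) :
    g ≫ σ e = σ (g ≫ e) := by simp [σ]

theorem PreExpansion.comp_σ_assoc {S T Z : C} (g : S ⟶ T) (e : T ⟶ PreExpansion X)
    (g' : Rigid X ⟶ Z) : g ≫ σ e ≫ g' = σ (g ≫ e) ≫ g' := by simp [σ]

theorem PreExpansion.comp_θ {S T : C} (g : S ⟶ T) (e : T ⟶ PreExpansion X) :
    g ≫ θ e = θ (g ≫ e) := by simp [θ]

theorem PreExpansion.comp_θ_assoc {S T Z : C} (g : S ⟶ T) (e : T ⟶ PreExpansion X)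
    (g' : Rigid X ⟶ Z) : g ≫ θ e ≫ g' = θ (g ≫ e) ≫ g' := by simp [θ]

theorem PreExpansion.comp_d {S T : C} (g : S ⟶ T) (e : T ⟶ PreExpansion X) :
    g ≫ d e = d (g ≫ e) := by simp [d]

theorem PreExpansion.comp_b {S T : C} (g : S ⟶ T) (e : T ⟶ PreExpansion X) :
    g ≫ b e = b (g ≫ e) := by simp [b]

theorem PreExpansion.σ_map {X Y T : C} (f : X ⟶ Y) (e : T ⟶ PreExpansion X) :
    σ (e ≫ map f) = σ e ≫ Rigid.map f := by simp [σ, map]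

theorem PreExpansion.θ_map {X Y T : C} (f : X ⟶ Y) (e : T ⟶ PreExpansion X) :
    θ (e ≫ map f) = θ e ≫ Rigid.map f := by simp [θ, map]

theorem PreExpansion.d_map {X Y T : C} (f : X ⟶ Y) (e : T ⟶ PreExpansion X) :
    d (e ≫ map f) = d e := by simp [d, map]

theorem PreExpansion.b_map {X Y T : C} (f : X ⟶ Y) (e : T ⟶ PreExpansion X) :
    b (e ≫ map f) = b e := by simp [b, map]

theorem map_expansionLHS {X Y : C} (f : X ⟶ Y) :
    PreExpansion.map f ≫ expansionLHS Y =
      expansionLHS X ≫ (_ ◁ (ihom (nat C)).map (nat C ◁ f)) := by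
  rw [expansionLHS, expansionLHS, lift_whiskerLeft, ← curry_natural_right, comp_lift,
    ← curry_natural_left]
  have h : PreExpansion.map f = 𝟙 _ ≫ PreExpansion.map f := (Category.id_comp _).symm
  congr 2
  · simp only [comp_lift, comp_app, comp_σ_assoc, comp_d, comp_toUnit_assoc, Category.comp_id]
    rw [h]
    simp only [σ_map, d_map, Category.assoc, Rigid.map_len]
  · simp only [comp_lift, comp_app, comp_σ, comp_d, whiskerLeft_fst, whiskerLeft_fst_assoc,
      whiskerLeft_snd, Rigid.comp_vertex, σ_map, d_map, Rigid.vertex_map, lift_whiskerLeft]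

theorem map_expansionRHS {X Y : C} (f : X ⟶ Y) :
    PreExpansion.map f ≫ expansionRHS Y =
      expansionRHS X ≫ (_ ◁ (ihom (nat C)).map (nat C ◁ f)) := by
  rw [expansionRHS, expansionRHS, lift_whiskerLeft, ← curry_natural_right, comp_lift,
    ← curry_natural_left]
  have h : PreExpansion.map f = 𝟙 _ ≫ PreExpansion.map f := (Category.id_comp _).symm
  congr 2
  · simp only [comp_lift, comp_θ_assoc, comp_toUnit_assoc, Category.comp_id]
    rw [h]
    simp only [θ_map, Category.assoc, Rigid.map_len]
  · simp only [comp_lift, comp_lift_assoc, comp_app, comp_app_assoc, comp_θ, comp_d, comp_b,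
      whiskerLeft_fst, whiskerLeft_snd, Rigid.comp_vertex, θ_map, d_map, b_map,
      Rigid.vertex_map, lift_whiskerLeft]

/-- The action of a morphism on expansions. -/
def Expansion.map {X Y : C} (f : X ⟶ Y) : Expansion X ⟶ Expansion Y :=
  equalizer.lift (ι ≫ PreExpansion.map f) (by
    rw [Category.assoc, Category.assoc, map_expansionLHS, map_expansionRHS, ← Category.assoc,
      condition, Category.assoc])

theorem Expansion.map_ι {X Y : C} (f : X ⟶ Y) :
    Expansion.map f ≫ ι = ι ≫ PreExpansion.map f :=
  equalizer.lift_ι _ _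

theorem Expansion.map_left {X Y : C} (f : X ⟶ Y) :
    Expansion.map f ≫ Expansion.left = Expansion.left ≫ Rigid.map f := by
  rw [left, left, comp_σ, map_ι, σ_map]

theorem Expansion.map_right {X Y : C} (f : X ⟶ Y) :
    Expansion.map f ≫ Expansion.right = Expansion.right ≫ Rigid.map f := by
  rw [right, right, comp_θ, map_ι, θ_map]

/-- An expansion has the same starting point. -/
theorem Expansion.vertex_zero (X : C) :
    Rigid.vertex (Expansion.left (X := X)) (toUnit _ ≫ zero C) =
      Rigid.vertex (Expansion.right (X := X)) (toUnit _ ≫ zero C) := by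
  have h1 := congr($(Expansion.condition (X := X)) ≫ fst _ _ ≫ fst _ _)
  have h2 := congr(app ($(Expansion.condition (X := X)) ≫ snd _ _) (toUnit _ ≫ zero C) ≫ snd _ _)
  simp only [expansionLHS, expansionRHS, Category.assoc, lift_fst_assoc, lift_fst, lift_snd,
    app_curry, comp_app, Rigid.comp_vertex, comp_d, comp_σ, comp_θ, comp_toUnit_assoc,
    Category.comp_id] at h1 h2
  rw [h1] at h2
  exact h2

end expansion

/-! ### The path object -/

/-- The Hurewicz path object `X ^ ⟨I⟩`: the quotient of the object of rigid paths by the equivalence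
relation generated by the relation `σ` is an expansion of `θ`. -/
def PathObject (X : C) : C := coequalizer (Expansion.left (X := X)) Expansion.right

/-- The class of a rigid path. -/
def PathObject.mk (X : C) : Rigid X ⟶ PathObject X := coequalizer.π _ _

theorem PathObject.condition (X : C) :
    Expansion.left ≫ PathObject.mk X = Expansion.right ≫ PathObject.mk X :=
  coequalizer.condition _ _

theorem PathObject.hom_ext {X Y : C} {f g : PathObject X ⟶ Y}
    (h : PathObject.mk X ≫ f = PathObject.mk X ≫ g) : f = g :=
  coequalizer.hom_ext h

/-- The source map `s` of the path object. -/
def PathObject.source (X : C) : PathObject X ⟶ X :=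
  coequalizer.desc (Rigid.vertex (𝟙 _) (toUnit _ ≫ zero C)) (by
    rw [Rigid.comp_vertex, Rigid.comp_vertex]
    simpa using Expansion.vertex_zero X)

theorem PathObject.mk_source (X : C) :
    PathObject.mk X ≫ PathObject.source X = Rigid.vertex (𝟙 _) (toUnit _ ≫ zero C) :=
  coequalizer.π_desc _ _

/-- The action of a morphism on paths, by postcomposition. -/
def PathObject.map {X Y : C} (f : X ⟶ Y) : PathObject X ⟶ PathObject Y :=
  coequalizer.desc (Rigid.map f ≫ PathObject.mk Y) (by
    rw [← Category.assoc, ← Category.assoc, ← Expansion.map_left, ← Expansion.map_right,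
      Category.assoc, Category.assoc, condition])

theorem PathObject.mk_map {X Y : C} (f : X ⟶ Y) :
    PathObject.mk X ≫ PathObject.map f = Rigid.map f ≫ PathObject.mk Y :=
  coequalizer.π_desc _ _

theorem PathObject.map_source {X Y : C} (f : X ⟶ Y) :
    PathObject.map f ≫ PathObject.source Y = PathObject.source X ≫ f := by
  apply hom_ext
  rw [← Category.assoc, ← Category.assoc, mk_map, mk_source, Category.assoc, mk_source,
    Rigid.comp_vertex, ← Rigid.vertex_map]
  simp

/-! ### Hurewicz fibrations -/

/-- The canonical map from `X ^ ⟨I⟩` to the pullback of `s : Y ^ ⟨I⟩ ⟶ Y` and `f : X ⟶ Y`. -/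
def pathLifting {X Y : C} (f : X ⟶ Y) :
    PathObject X ⟶ pullback (PathObject.source Y) f :=
  pullback.lift (PathObject.map f) (PathObject.source X) (PathObject.map_source f)

/-- A Hurewicz connection on `f`. -/
structure HurewiczConnection {X Y : C} (f : X ⟶ Y) where
  /-- The underlying morphism. -/
  h : pullback (PathObject.source Y) f ⟶ PathObject X
  isSection : h ≫ pathLifting f = 𝟙 _

variable (C) in
/-- The class of Hurewicz fibrations. -/
def hurewiczFibrations : MorphismProperty C := fun _ _ f => Nonempty (HurewiczConnection f)

end

/-- A class of fibrations. -/
structure IsFibrationClass {C : Type u} [Category.{v} C] (F : MorphismProperty C) : Prop where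
  of_isIso {X Y : C} (f : X ⟶ Y) [IsIso f] : F f
  comp {X Y Z : C} (f : X ⟶ Y) (g : Y ⟶ Z) : F f → F g → F (f ≫ g)
  baseChange {X' X Y' Y : C} {g' : X' ⟶ X} {f' : X' ⟶ Y'} {f : X ⟶ Y} {g : Y' ⟶ Y} :
    IsPullback g' f' f g → F f → F f'

/-- A tribe: a class of fibrations for which every object is fibrant. -/
structure IsTribe {C : Type u} [Category.{v} C] [CartesianMonoidalCategory C]
    (F : MorphismProperty C) : Prop extends IsFibrationClass F where
  fibrant (X : C) : F (toUnit X)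

end Hurewicz

end HTopos

/-!
In an elementary topos the interval `I` is covered by its two end points, so it is the quotient of
`1 + 1` that identifies these points over the subobject `U` of `1` on which `#0 = #1`. An element of
`X ^ I` is therefore nothing but a pair of elements of `X` that become equal over `U`. This relation
`UEq` is defined here by generalized elements, without `U` itself. It is an equivalence relation,
preserved by all morphisms, and `exists_path_of_uEq` glues two such elements to a path: the set of
all `x` with `i = #0 → x = a` and `i = #1 → x = b` is a singleton for `i = #0` and for `i = #1`,
hence for all `i`. So a rigid path is a finite sequence of vertices all of which are `U`-equal.

It follows that a morphism `f : X ⟶ Y` is a Hurewicz fibration if and only if it has a `Transport`: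
a natural way to move an element `x` of `X` to an element `U`-equal to `x` over any given `y` that
is `U`-equal to `f x` (`hurewiczFibrations_iff`). Transports visibly exist on isomorphisms and on
morphisms to the terminal object, compose, and are stable under base change, which gives the result.

A Hurewicz connection gives a transport by lifting the path of length `1` from `f x` to `y` and
taking the target of the lift. Conversely, a transport lifts a path `y_0, ..., y_n` that starts at
`f x` to `x, t(x, y_0), ..., t(x, y_n)`. All these vertices come from the one point `x`, so an
expansion of the path is lifted to an expansion of the lift. The vertex `x` has to be prepended
because `t(x, f x)` may differ from `x`; it makes the lift a path over `y_0, y_0, ..., y_n`, an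
expansion of the given path. To define this on `P Y ×_Y X`, where `P Y` is the path object, one
needs that the coequalizer `P Y ⊗ X` of `Rigid Y ⊗ X` remains one when it is pulled back along the
monomorphism `P Y ×_Y X ⟶ P Y ⊗ X`. This is `exists_desc_of_isPullback`, a consequence of the
Beck-Chevalley condition for power objects.
-/

open CategoryTheory Limits MonoidalCategory CartesianMonoidalCategory

namespace HTopos

/-! ### Subobjects and descent in a topos -/

section Subobjects

variable {C : Type u} [Category.{v} C]

theorem le_of_forall_factors {W : C} {S D : Subobject W}
    (h : ∀ ⦃V : C⦄ (w : V ⟶ W), S.Factors w → D.Factors w) : S ≤ D :=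
  Subobject.le_of_factors (h _ (Subobject.factors_self S))

theorem eq_of_forall_factors {W : C} {S D : Subobject W}
    (h : ∀ ⦃V : C⦄ (w : V ⟶ W), S.Factors w ↔ D.Factors w) : S = D :=
  le_antisymm (le_of_forall_factors fun _ w => (h w).1) (le_of_forall_factors fun _ w => (h w).2)

theorem mk_factors_iff_exists {V S W : C} (m : S ⟶ W) [Mono m] (w : V ⟶ W) :
    (Subobject.mk m).Factors w ↔ ∃ k : V ⟶ S, k ≫ m = w :=
  Subobject.mk_factors_iff m w

variable [CartesianMonoidalCategory C]

/-- The graph of a partial morphism from `A` to `Z`, defined on the subobject `b : W ⟶ A`. -/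
noncomputable def partialGraph {W A Z : C} (b : W ⟶ A) [Mono b] (φ : W ⟶ Z) : Subobject (Z ⊗ A) :=
  haveI : Mono (lift φ b) := mono_of_mono_fac (lift_snd φ b)
  Subobject.mk (lift φ b)

theorem partialGraph_factors_iff {W A Z T : C} (b : W ⟶ A) [Mono b] (φ : W ⟶ Z)
    (z : T ⟶ Z ⊗ A) :
    (partialGraph b φ).Factors z ↔ ∃ w : T ⟶ W, w ≫ φ = z ≫ fst _ _ ∧ w ≫ b = z ≫ snd _ _ := by
  rw [partialGraph, mk_factors_iff_exists]
  refine exists_congr fun w => ⟨fun h => ?_, fun h => ?_⟩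
  · rw [← h]; simp
  · ext <;> simp [h]

theorem graph_factors_iff {X B T : C} (b : X ⟶ B) (z : T ⟶ B ⊗ X) :
    (graph b).Factors z ↔ z ≫ fst _ _ = (z ≫ snd _ _) ≫ b := by
  rw [graph, mk_factors_iff_exists]
  constructor
  · rintro ⟨w, hw⟩
    rw [← hw]; simp
  · intro h
    exact ⟨z ≫ snd _ _, by ext <;> simp [h]⟩

variable [Topos C]

/-- Two subobjects have the same pullback along `w` exactly when they contain the same generalized
elements of the form `v ≫ w`. -/
theorem pullback_eq_pullback_iff {V W : C} (w : V ⟶ W) (S D : Subobject W) :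
    (Subobject.pullback w).obj S = (Subobject.pullback w).obj D ↔
      ∀ ⦃V' : C⦄ (v : V' ⟶ V), S.Factors (v ≫ w) ↔ D.Factors (v ≫ w) := by
  constructor
  · intro h V' v
    rw [← pullback_factors_iff, h, pullback_factors_iff]
  · intro h
    refine eq_of_forall_factors fun V' v => ?_
    rw [pullback_factors_iff, pullback_factors_iff, h]

/-- The characteristic morphism of a subobject. -/
noncomputable def chi {W : C} (S : Subobject W) : W ⟶ pow (𝟙_ C) :=
  rel.symm ((Subobject.pullback (λ_ W).hom).obj S)

theorem comp_chi_eq_iff {V W : C} (w : V ⟶ W) (S D : Subobject W) :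
    w ≫ chi S = w ≫ chi D ↔
      ∀ ⦃V' : C⦄ (v : V' ⟶ V), S.Factors (v ≫ w) ↔ D.Factors (v ≫ w) := by
  rw [chi, chi, comp_rel_symm, comp_rel_symm, rel.symm.injective.eq_iff,
    ← Subobject.pullback_comp, ← Subobject.pullback_comp, pullback_eq_pullback_iff]
  constructor
  · intro h V' v
    simpa using h (v ≫ (λ_ V).inv)
  · intro h V' v
    simpa using h (v ≫ (λ_ V).hom)

/-- The Heyting implication of subobjects. -/
noncomputable def imp {W : C} (S D : Subobject W) : Subobject W :=
  equalizerSubobject (chi S) (chi (S ⊓ D))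

theorem imp_factors_iff {V W : C} (w : V ⟶ W) (S D : Subobject W) :
    (imp S D).Factors w ↔ ∀ ⦃V' : C⦄ (v : V' ⟶ V), S.Factors (v ≫ w) → D.Factors (v ≫ w) := by
  simp only [imp, equalizerSubobject_factors_iff, comp_chi_eq_iff, Subobject.inf_factors]
  exact forall₂_congr fun _ _ => by tauto

theorem exists_lift_of_epi_of_mono {A B X Y : C} (e : A ⟶ B) [Epi e] (m : X ⟶ Y) [Mono m]
    {f : A ⟶ X} {g : B ⟶ Y} (h : f ≫ m = e ≫ g) : ∃ k : B ⟶ X, e ≫ k = f ∧ k ≫ m = g := by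
  have : IsRegularMono m := IsRegularMonoCategory.regularMonoOfMono m
  have : HasLiftingProperty e m := StrongMono.rlp e
  exact ⟨(CommSq.mk h).lift, CommSq.fac_left _, CommSq.fac_right _⟩

/-- Epimorphisms are stable under pullback along monomorphisms: inverse image along the pullback
is a monomorphism by the Beck-Chevalley condition. -/
theorem epi_of_isPullback_of_mono {W A S B : C} {b : W ⟶ A} {a : W ⟶ S} {m : S ⟶ B} {e : A ⟶ B}
    (h : IsPullback a b m e) [Mono m] [Epi e] : Epi a := by
  have : Mono b := h.mono_snd_of_mono
  have : (powFunctor C).IsRightAdjoint := powAdj.isRightAdjoint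
  have he : Mono (powMap e) := inferInstanceAs (Mono ((powFunctor C).map e.op))
  have : Mono (powEx m) := (SplitMono.mk (powMap m) (powEx_powMap_self m)).mono
  have ha : Mono (powMap a) := by
    have := mono_comp (powEx m) (powMap e)
    rw [powEx_powMap h] at this
    exact mono_of_mono (powMap a) (powEx b)
  have : Mono ((powFunctor C).map a.op) := ha
  have : Mono a.op := (powFunctor C).mono_of_mono_map this
  exact unop_epi_of_mono a.op

/-- Descent along the pullback of a coequalizer `e` along a monomorphism `m`. The hypothesis `desc`
says that morphisms to power objects descend along `e`; the partial morphism `φ` is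
turned into a total one by passing to the power object of its codomain. -/
theorem exists_desc_of_isPullback {R W A S B Z : C} {l r : R ⟶ A} {b : W ⟶ A} {a : W ⟶ S}
    {m : S ⟶ B} {e : A ⟶ B} (h : IsPullback a b m e) [Mono m] [Epi e] (hlr : l ≫ e = r ≫ e)
    (desc : ∀ k : A ⟶ pow Z, l ≫ k = r ≫ k → ∃ g : B ⟶ pow Z, e ≫ g = k) (φ : W ⟶ Z)
    (hφ : ∀ ⦃T : C⦄ (w w' : T ⟶ W) (ρ : T ⟶ R), w ≫ b = ρ ≫ l → w' ≫ b = ρ ≫ r →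
      w ≫ φ = w' ≫ φ) : ∃ g : S ⟶ Z, a ≫ g = φ := by
  have : Mono b := h.mono_snd_of_mono
  have : Epi a := epi_of_isPullback_of_mono h
  obtain ⟨g, hg⟩ := desc (rel.symm (partialGraph b φ)) (by
    rw [comp_rel_symm, comp_rel_symm, rel.symm.injective.eq_iff]
    refine eq_of_forall_factors fun T z => ?_
    simp only [pullback_factors_iff, partialGraph_factors_iff, Category.assoc, whiskerLeft_fst,
      whiskerLeft_snd]
    constructor
    · rintro ⟨w, h1, h2⟩
      have h3 : (w ≫ a) ≫ m = (z ≫ snd _ _ ≫ r) ≫ e := by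
        rw [Category.assoc, h.w, reassoc_of% h2, hlr]; simp
      exact ⟨h.lift _ _ h3, by
        rw [← h1]
        exact (hφ _ _ (z ≫ snd _ _) (by simpa using h2) (by simp)).symm, by simp⟩
    · rintro ⟨w, h1, h2⟩
      have h3 : (w ≫ a) ≫ m = (z ≫ snd _ _ ≫ l) ≫ e := by
        rw [Category.assoc, h.w, reassoc_of% h2, ← hlr]; simp
      exact ⟨h.lift _ _ h3, by
        rw [← h1]
        exact hφ _ _ (z ≫ snd _ _) (by simp) (by simpa using h2), by simp⟩)
  -- On `S` the descended relation `g` is single-valued, since `a` is epi and `singleton` mono.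
  have key : φ ≫ singleton Z = a ≫ m ≫ g := by
    rw [h.w_assoc, hg, comp_rel_symm, comp_singleton, rel.symm.injective.eq_iff]
    refine eq_of_forall_factors fun T z => ?_
    simp only [pullback_factors_iff, partialGraph_factors_iff, graph_factors_iff, Category.assoc,
      whiskerLeft_fst, whiskerLeft_snd]
    constructor
    · intro hz
      exact ⟨z ≫ snd _ _, by simp [hz], by simp⟩
    · rintro ⟨w, h1, h2⟩
      have : w = z ≫ snd _ _ := by rw [← cancel_mono b]; simpa using h2
      rw [← h1, this, Category.assoc]
  obtain ⟨k, hk, -⟩ := exists_lift_of_epi_of_mono a (singleton Z) key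
  exact ⟨k, hk⟩

end Subobjects

/-! ### Equality where the end points of the interval agree -/

section Hurewicz

open MonoidalClosed
open scoped CartesianClosed

variable {C : Type u} [Category.{v} C] [CartesianMonoidalCategory C] [HurewiczTopos C]

/-- Two generalized elements are `U`-equal if they become equal wherever the end points of the
interval are equal, i.e. over the subobject `U` of the terminal object on which `#0 = #1`. -/
def UEq {T X : C} (a b : T ⟶ X) : Prop :=
  ∀ ⦃V : C⦄ (v : V ⟶ T), toUnit V ≫ pt0 C = toUnit V ≫ pt1 C → v ≫ a = v ≫ b

namespace UEq

variable {T X Y : C} {a b c : T ⟶ X}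

theorem refl (a : T ⟶ X) : UEq a a := fun _ _ _ => rfl

theorem symm (h : UEq a b) : UEq b a := fun _ v hv => (h v hv).symm

theorem trans (h : UEq a b) (h' : UEq b c) : UEq a c := fun _ v hv => (h v hv).trans (h' v hv)

theorem precomp {S : C} (f : S ⟶ T) (h : UEq a b) : UEq (f ≫ a) (f ≫ b) := fun _ v hv => by
  simpa using h (v ≫ f) hv

theorem postcomp (f : X ⟶ Y) (h : UEq a b) : UEq (a ≫ f) (b ≫ f) := fun _ v hv => by
  rw [← Category.assoc, h v hv, Category.assoc]

end UEq

theorem comp_evalAt {T X : C} (q : 𝟙_ C ⟶ ival C) (p : T ⟶ ival C ⟹ X) :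
    p ≫ evalAt q X = app p (toUnit _ ≫ q) := by
  rw [evalAt, comp_app]; simp

theorem ival_ext {X : C} {f g : ival C ⟶ X} (h0 : pt0 C ≫ f = pt0 C ≫ g)
    (h1 : pt1 C ≫ f = pt1 C ≫ g) : f = g :=
  HurewiczTopos.interval.hom_ext f g h0 h1

/-- The end points of the interval are jointly epimorphic also in the presence of parameters. -/
theorem ival_tensor_hom_ext {T X : C} {f g : ival C ⊗ T ⟶ X}
    (h0 : lift (toUnit T ≫ pt0 C) (𝟙 T) ≫ f = lift (toUnit T ≫ pt0 C) (𝟙 T) ≫ g)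
    (h1 : lift (toUnit T ≫ pt1 C) (𝟙 T) ≫ f = lift (toUnit T ≫ pt1 C) (𝟙 T) ≫ g) : f = g := by
  have key (q : 𝟙_ C ⟶ ival C) (f : ival C ⊗ T ⟶ X) :
      q ≫ curry (lift (snd _ _) (fst _ _) ≫ f) =
        curry (fst _ _ ≫ lift (toUnit T ≫ q) (𝟙 T) ≫ f) := by
    rw [← curry_natural_left, ← Category.assoc, ← Category.assoc]
    congr 2
    ext <;> simp [toUnit_unique (snd T (𝟙_ C)) (fst T (𝟙_ C) ≫ toUnit T)]
  have h : curry (lift (snd _ _) (fst _ _) ≫ f) = curry (lift (snd _ _) (fst _ _) ≫ g) :=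
    ival_ext (by rw [key, key, h0]) (by rw [key, key, h1])
  rw [← Category.id_comp f, ← Category.id_comp g, ← swap_swap, Category.assoc, Category.assoc,
    curry_injective h]

theorem comp_evalAt_eq_uncurry {T X : C} (q : 𝟙_ C ⟶ ival C) (p : T ⟶ ival C ⟹ X) :
    p ≫ evalAt q X = lift (toUnit _ ≫ q) (𝟙 T) ≫ uncurry p := by
  rw [comp_evalAt, ← app_curry, curry_uncurry, Category.id_comp]

/-- Morphisms into `X ^ I` are determined by their end points. -/
theorem ival_hom_ext {T X : C} {p q : T ⟶ ival C ⟹ X}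
    (h0 : p ≫ evalAt (pt0 C) X = q ≫ evalAt (pt0 C) X)
    (h1 : p ≫ evalAt (pt1 C) X = q ≫ evalAt (pt1 C) X) : p = q := by
  apply uncurry_injective
  apply ival_tensor_hom_ext
  · rwa [← comp_evalAt_eq_uncurry, ← comp_evalAt_eq_uncurry]
  · rwa [← comp_evalAt_eq_uncurry, ← comp_evalAt_eq_uncurry]

/-- The morphism `I ⊗ T ⟶ P X` whose value at `(i, t)` is the set of all `x` such that `x = a t` if
`i` is `#0`, and `x = b t` if `i` is `#1`. -/
noncomputable def glueSet {T X : C} (a b : T ⟶ X) : ival C ⊗ T ⟶ pow X :=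
  let x : X ⊗ (ival C ⊗ T) ⟶ X := fst _ _
  let i : X ⊗ (ival C ⊗ T) ⟶ ival C := snd _ _ ≫ fst _ _
  let t : X ⊗ (ival C ⊗ T) ⟶ T := snd _ _ ≫ snd _ _
  rel.symm
    (imp (equalizerSubobject i (toUnit _ ≫ pt0 C)) (equalizerSubobject x (t ≫ a)) ⊓
      imp (equalizerSubobject i (toUnit _ ≫ pt1 C)) (equalizerSubobject x (t ≫ b)))

theorem glueSet_pt0 {T X : C} {a b : T ⟶ X} (h : UEq a b) :
    lift (toUnit _ ≫ pt0 C) (𝟙 T) ≫ glueSet a b = a ≫ singleton X := by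
  rw [glueSet, comp_rel_symm, comp_singleton, rel.symm.injective.eq_iff]
  refine eq_of_forall_factors fun V w => ?_
  simp only [pullback_factors_iff, Subobject.inf_factors, imp_factors_iff,
    equalizerSubobject_factors_iff, graph_factors_iff]
  simp
  constructor
  · rintro ⟨h1, -⟩
    simpa using h1 (𝟙 _)
  · intro hw
    refine ⟨fun V' v => by rw [hw], fun V' v hv => ?_⟩
    rw [hw]
    simpa using h (v ≫ w ≫ snd _ _) (by simpa using hv)

theorem glueSet_pt1 {T X : C} {a b : T ⟶ X} (h : UEq a b) :
    lift (toUnit _ ≫ pt1 C) (𝟙 T) ≫ glueSet a b = b ≫ singleton X := by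
  rw [glueSet, comp_rel_symm, comp_singleton, rel.symm.injective.eq_iff]
  refine eq_of_forall_factors fun V w => ?_
  simp only [pullback_factors_iff, Subobject.inf_factors, imp_factors_iff,
    equalizerSubobject_factors_iff, graph_factors_iff]
  simp
  constructor
  · rintro ⟨-, h1⟩
    simpa using h1 (𝟙 _)
  · intro hw
    refine ⟨fun V' v hv => ?_, fun V' v => by rw [hw]⟩
    rw [hw]
    simpa using (h (v ≫ w ≫ snd _ _) (by simpa using hv.symm)).symm

/-- `U`-equal elements are the end points of an element of `X ^ I`. -/
theorem exists_path_of_uEq {T X : C} {a b : T ⟶ X} (h : UEq a b) :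
    ∃ p : T ⟶ ival C ⟹ X, p ≫ evalAt (pt0 C) X = a ∧ p ≫ evalAt (pt1 C) X = b := by
  -- The subobject of `I ⊗ T` on which `glueSet` is a singleton contains both end points.
  let e : pullback (glueSet a b) (singleton X) ⟶ ival C ⊗ T := pullback.fst _ _
  have he : Epi e := ⟨fun f g hfg => by
    apply ival_tensor_hom_ext
    · rw [← pullback.lift_fst _ _ (glueSet_pt0 h), Category.assoc, Category.assoc]
      exact congr(_ ≫ $hfg)
    · rw [← pullback.lift_fst _ _ (glueSet_pt1 h), Category.assoc, Category.assoc]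
      exact congr(_ ≫ $hfg)⟩
  obtain ⟨k, -, hk⟩ := exists_lift_of_epi_of_mono e (singleton X) pullback.condition.symm
  refine ⟨curry k, ?_, ?_⟩
  · rw [comp_evalAt_eq_uncurry, uncurry_curry, ← cancel_mono (singleton X), Category.assoc, hk,
      glueSet_pt0 h]
  · rw [comp_evalAt_eq_uncurry, uncurry_curry, ← cancel_mono (singleton X), Category.assoc, hk,
      glueSet_pt1 h]

theorem UEq.of_path {T X : C} (p : T ⟶ ival C ⟹ X) :
    UEq (p ≫ evalAt (pt0 C) X) (p ≫ evalAt (pt1 C) X) := fun V v hv => by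
  simp only [comp_evalAt, comp_app, comp_toUnit_assoc, hv]

/-! ### Recursion on the natural numbers object -/

theorem zero_natRec {X : C} (a : 𝟙_ C ⟶ X) (f : X ⟶ X) : zero C ≫ natRec a f = a :=
  (HurewiczTopos.nno.existsUnique_rec a f).choose_spec.1.1

theorem succ_natRec {X : C} (a : 𝟙_ C ⟶ X) (f : X ⟶ X) :
    succ C ≫ natRec a f = natRec a f ≫ f :=
  (HurewiczTopos.nno.existsUnique_rec a f).choose_spec.1.2

theorem nat_hom_ext {X : C} (f : X ⟶ X) {g h : nat C ⟶ X} (h0 : zero C ≫ g = zero C ≫ h)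
    (hg : succ C ≫ g = g ≫ f) (hh : succ C ≫ h = h ≫ f) : g = h :=
  (HurewiczTopos.nno.existsUnique_rec (zero C ≫ h) f).unique ⟨h0, hg⟩ ⟨rfl, hh⟩

/-- Induction with parameters in `W`. -/
theorem nat_tensor_hom_ext {W Z : C} (F : Z ⟶ Z) {g h : nat C ⊗ W ⟶ Z}
    (h0 : lift (toUnit W ≫ zero C) (𝟙 W) ≫ g = lift (toUnit W ≫ zero C) (𝟙 W) ≫ h)
    (hg : succ C ▷ W ≫ g = g ≫ F) (hh : succ C ▷ W ≫ h = h ≫ F) : g = h := by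
  have key0 (f : nat C ⊗ W ⟶ Z) :
      zero C ≫ curry (lift (snd _ _) (fst _ _) ≫ f) =
        curry (fst _ _ ≫ lift (toUnit W ≫ zero C) (𝟙 W) ≫ f) := by
    rw [← curry_natural_left, ← Category.assoc, ← Category.assoc]
    congr 2
    ext <;> simp [toUnit_unique (snd W (𝟙_ C)) (fst W (𝟙_ C) ≫ toUnit W)]
  have key1 (f : nat C ⊗ W ⟶ Z) (hf : succ C ▷ W ≫ f = f ≫ F) :
      succ C ≫ curry (lift (snd _ _) (fst _ _) ≫ f) =
        curry (lift (snd _ _) (fst _ _) ≫ f) ≫ (ihom W).map F := by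
    rw [← curry_natural_left, ← curry_natural_right, Category.assoc, ← hf]
    congr 1
    rw [← Category.assoc, ← swap_whisker', Category.assoc]
  have e : curry (lift (snd _ _) (fst _ _) ≫ g) = curry (lift (snd _ _) (fst _ _) ≫ h) :=
    nat_hom_ext ((ihom W).map F) (by rw [key0, key0, h0]) (key1 g hg) (key1 h hh)
  rw [← Category.id_comp g, ← Category.id_comp h, ← swap_swap, Category.assoc, Category.assoc,
    curry_injective e]

/-- Iteration with parameters in `W`: the value at `0` is `a`, and a step applies `F`. -/
noncomputable def natIter {W Z : C} (a : W ⟶ Z) (F : Z ⟶ Z) : nat C ⊗ W ⟶ Z :=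
  lift (snd _ _) (fst _ _) ≫ uncurry (natRec (curry (fst W (𝟙_ C) ≫ a)) ((ihom W).map F))

theorem zero_natIter {W Z : C} (a : W ⟶ Z) (F : Z ⟶ Z) :
    lift (toUnit W ≫ zero C) (𝟙 W) ≫ natIter a F = a := by
  have h := congr(lift (𝟙 W) (toUnit W) ≫
    uncurry $(zero_natRec (curry (fst W (𝟙_ C) ≫ a)) ((ihom W).map F)))
  rw [uncurry_curry, uncurry_natural_left] at h
  rw [natIter]
  simpa [← Category.assoc] using h

theorem succ_natIter {W Z : C} (a : W ⟶ Z) (F : Z ⟶ Z) :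
    succ C ▷ W ≫ natIter a F = natIter a F ≫ F := by
  have h := congr(lift (snd _ _) (fst _ _) ≫
    uncurry $(succ_natRec (curry (fst W (𝟙_ C) ≫ a)) ((ihom W).map F)))
  rw [uncurry_natural_left, uncurry_natural_right, ← Category.assoc, swap_whisker] at h
  rw [natIter, Category.assoc, ← h, Category.assoc]

theorem lift_zero_natIter {T W Z : C} (a : W ⟶ Z) (F : Z ⟶ Z) (w : T ⟶ W) :
    lift (toUnit T ≫ zero C) w ≫ natIter a F = w ≫ a := by
  conv_rhs => rw [← zero_natIter a F]
  rw [comp_lift_assoc]; simp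

theorem lift_succ_natIter {T W Z : C} (a : W ⟶ Z) (F : Z ⟶ Z) (k : T ⟶ nat C) (w : T ⟶ W) :
    lift (k ≫ succ C) w ≫ natIter a F = lift k w ≫ natIter a F ≫ F := by
  rw [← succ_natIter, lift_whiskerRight_assoc]

/-- The step of the recursion that defines `natCases`: it acts on triples `(w, k, x)`. -/
noncomputable def natCasesStep {W X : C} (s : nat C ⊗ W ⟶ X) :
    W ⊗ (nat C ⊗ X) ⟶ W ⊗ (nat C ⊗ X) :=
  lift (fst _ _) (lift (snd _ _ ≫ fst _ _ ≫ succ C) (lift (snd _ _ ≫ fst _ _) (fst _ _) ≫ s))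

/-- Definition by cases: the value at `0` is `z`, the value at `k + 1` is `s k`. -/
noncomputable def natCases {W X : C} (z : W ⟶ X) (s : nat C ⊗ W ⟶ X) : nat C ⊗ W ⟶ X :=
  natIter (lift (𝟙 W) (lift (toUnit W ≫ zero C) z)) (natCasesStep s) ≫ snd _ _ ≫ snd _ _

theorem lift_zero_natCases {T W X : C} (z : W ⟶ X) (s : nat C ⊗ W ⟶ X) (w : T ⟶ W) :
    lift (toUnit T ≫ zero C) w ≫ natCases z s = w ≫ z := by
  rw [natCases, ← Category.assoc, lift_zero_natIter]; simp

theorem lift_succ_natCases {T W X : C} (z : W ⟶ X) (s : nat C ⊗ W ⟶ X) (k : T ⟶ nat C)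
    (w : T ⟶ W) : lift (k ≫ succ C) w ≫ natCases z s = lift k w ≫ s := by
  let u := natIter (lift (𝟙 W) (lift (toUnit W ≫ zero C) z)) (natCasesStep s)
  have h1 : u ≫ fst _ _ = snd _ _ := by
    refine nat_tensor_hom_ext (𝟙 _) ?_ ?_ ?_
    · simp [u, ← Category.assoc, zero_natIter]
    · simp [u, ← Category.assoc, succ_natIter]
      simp [natCasesStep]
    · simp
  have h2 : u ≫ snd _ _ ≫ fst _ _ = fst _ _ := by
    refine nat_tensor_hom_ext (succ C) ?_ ?_ ?_
    · simp [u, ← Category.assoc, zero_natIter]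
    · simp only [u, ← Category.assoc, succ_natIter]
      simp [natCasesStep]
    · simp
  rw [natCases, ← Category.assoc, lift_succ_natIter]
  simp only [natCasesStep, Category.assoc]
  change _ ≫ u ≫ _ = _
  congr 1
  simp [comp_lift_assoc, h1, h2]

theorem succ_natCases {W X : C} (z : W ⟶ X) (s : nat C ⊗ W ⟶ X) :
    succ C ▷ W ≫ natCases z s = s := by
  have e : succ C ▷ W = lift (fst _ _ ≫ succ C) (snd _ _) := by ext <;> simp
  rw [e, lift_succ_natCases, lift_fst_snd, Category.id_comp]

/-- Morphisms out of `N ⊗ W` are determined by their values at `0` and at successors. -/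
theorem nat_cases_ext {W X : C} {g h : nat C ⊗ W ⟶ X}
    (h0 : lift (toUnit W ≫ zero C) (𝟙 W) ≫ g = lift (toUnit W ≫ zero C) (𝟙 W) ≫ h)
    (h1 : succ C ▷ W ≫ g = succ C ▷ W ≫ h) : g = h := by
  have key (g : nat C ⊗ W ⟶ X) :
      lift (snd _ _) (lift (fst _ _) g) =
        natIter (lift (𝟙 W) (lift (toUnit W ≫ zero C) (lift (toUnit W ≫ zero C) (𝟙 W) ≫ g)))
          (natCasesStep (succ C ▷ W ≫ g)) := by
    refine nat_tensor_hom_ext (natCasesStep (succ C ▷ W ≫ g)) ?_ ?_ (succ_natIter _ _)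
    · rw [zero_natIter]
      simp [comp_lift]
    · have e : succ C ▷ W = lift (fst _ _ ≫ succ C) (snd _ _) := by ext <;> simp
      simp [natCasesStep, comp_lift, comp_lift_assoc, e]
  have h2 := (key g).trans (by rw [h0, h1, ← key])
  simpa using congr($h2 ≫ snd _ _ ≫ snd _ _)

theorem lift_add {T : C} (a k : T ⟶ nat C) :
    lift a k ≫ add C = lift k a ≫ natIter (𝟙 _) (succ C) := by
  simp [natIter, add, comp_lift_assoc]

theorem add_zero {T : C} (a : T ⟶ nat C) : lift a (toUnit T ≫ zero C) ≫ add C = a := by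
  rw [lift_add, lift_zero_natIter, Category.comp_id]

theorem add_succ {T : C} (a k : T ⟶ nat C) :
    lift a (k ≫ succ C) ≫ add C = lift a k ≫ add C ≫ succ C := by
  rw [lift_add, lift_succ_natIter, ← Category.assoc, ← lift_add, Category.assoc]

theorem succ_add {T : C} (a k : T ⟶ nat C) :
    lift (a ≫ succ C) k ≫ add C = lift a k ≫ add C ≫ succ C := by
  have h : nat C ◁ succ C ≫ natIter (𝟙 _) (succ C) = natIter (𝟙 _) (succ C) ≫ succ C := by
    refine nat_tensor_hom_ext (succ C) ?_ ?_ ?_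
    · rw [← Category.assoc, ← Category.assoc, zero_natIter, lift_whiskerLeft, lift_zero_natIter]
      simp
    · rw [← whisker_exchange_assoc, succ_natIter, Category.assoc]
    · rw [← Category.assoc, succ_natIter, Category.assoc]
  rw [← Category.assoc, lift_add, lift_add, Category.assoc, ← h, lift_whiskerLeft_assoc]

variable (C) in
/-- The element of `2` that `bit` sends to `0`. -/
noncomputable def bit0 : 𝟙_ C ⟶ two C := coprod.inl

variable (C) in
/-- The element of `2` that `bit` sends to `1`. -/
noncomputable def bit1 : 𝟙_ C ⟶ two C := coprod.inr

theorem bit0_bit : bit0 C ≫ bit C = zero C := coprod.inl_desc _ _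

theorem bit1_bit : bit1 C ≫ bit C = zero C ≫ succ C := coprod.inr_desc _ _

/-! ### Rigid paths and expansions by generalized elements -/

theorem curry_app_fst {T A Y : C} (s : T ⟶ A ⟹ Y) : curry (app (snd A T ≫ s) (fst A T)) = s := by
  conv_rhs => rw [← curry_uncurry s]
  conv_lhs => rw [← curry_uncurry s, app_curry, lift_fst_snd, Category.id_comp]

namespace PreRigid

variable {X T : C}

theorem comp_steps_lift {S : C} (v : S ⟶ T) (n : T ⟶ nat C) (s : T ⟶ nat C ⟹ (ival C ⟹ X)) :
    steps (v ≫ lift n s) = v ≫ s := by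
  rw [← comp_steps, steps, lift_snd]

theorem comp_len_lift {S : C} (v : S ⟶ T) (n : T ⟶ nat C) (s : T ⟶ nat C ⟹ (ival C ⟹ X)) :
    len (v ≫ lift n s) = v ≫ n := by
  rw [← comp_len, len, lift_fst]

/-- The equations that define rigid paths, for generalized elements. -/
theorem comp_lhs_eq_comp_rhs (e : T ⟶ PreRigid X)
    (h : app (steps (snd (nat C) T ≫ e)) (fst _ _) ≫ evalAt (pt1 C) X =
      app (steps (snd (nat C) T ≫ e)) (fst _ _ ≫ succ C) ≫ evalAt (pt0 C) X)
    (h' : app (steps (snd (nat C) T ≫ e)) (lift (len (snd (nat C) T ≫ e)) (fst _ _) ≫ add C) ≫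
        evalAt (pt0 C) X =
      app (steps (snd (nat C) T ≫ e)) (len (snd (nat C) T ≫ e)) ≫ evalAt (pt0 C) X) :
    e ≫ rigidLHS X = e ≫ rigidRHS X := by
  rw [rigidLHS, rigidRHS, ← curry_natural_left, ← curry_natural_left]
  congr 1
  simp only [comp_lift, comp_app_assoc, comp_lift_assoc, comp_steps, comp_len,
    whiskerLeft_fst, whiskerLeft_snd, whiskerLeft_fst_assoc, h, h']

end PreRigid

namespace Rigid

variable {X W T : C}

theorem step_pt1 (σ : T ⟶ Rigid X) (k : T ⟶ nat C) :
    app (σ ≫ steps) k ≫ evalAt (pt1 C) X = vertex σ (k ≫ succ C) := by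
  have h := congr(app (σ ≫ $(condition (X := X))) k ≫ fst _ _)
  simpa only [rigidLHS, rigidRHS, ← Category.assoc, app_curry, comp_lift, lift_fst, comp_app,
    PreRigid.comp_steps, lift_snd, vertex, steps] using h

theorem vertex_add_len (σ : T ⟶ Rigid X) (k : T ⟶ nat C) :
    vertex σ (lift (σ ≫ len) k ≫ add C) = vertex σ (σ ≫ len) := by
  have h := congr(app (σ ≫ $(condition (X := X))) k ≫ snd _ _)
  simpa only [rigidLHS, rigidRHS, ← Category.assoc, app_curry, comp_lift, lift_fst, comp_app,
    PreRigid.comp_steps, PreRigid.comp_len, lift_snd, vertex, steps, len] using h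

theorem uEq_vertex_succ (σ : T ⟶ Rigid X) (k : T ⟶ nat C) :
    UEq (vertex σ k) (vertex σ (k ≫ succ C)) := by
  rw [← step_pt1]
  exact UEq.of_path _

/-- A rigid path is determined by its length and its vertices. -/
theorem hom_ext {σ τ : T ⟶ Rigid X} (hlen : σ ≫ len = τ ≫ len)
    (h : vertex (snd _ _ ≫ σ) (fst (nat C) T) = vertex (snd _ _ ≫ τ) (fst (nat C) T)) :
    σ = τ := by
  have hs : σ ≫ steps = τ ≫ steps := by
    rw [← curry_app_fst (σ ≫ steps), ← curry_app_fst (τ ≫ steps)]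
    congr 1
    apply ival_hom_ext
    · simpa only [vertex, Category.assoc] using h
    · have h' := congr(succ C ▷ T ≫ $h)
      rw [← Category.assoc, ← Category.assoc, step_pt1, step_pt1]
      simpa only [comp_vertex, whiskerRight_fst, whiskerRight_snd_assoc] using h'
  have : Mono (ι (X := X)) := inferInstanceAs (Mono (equalizer.ι _ _))
  rw [← cancel_mono ι]
  ext
  · simpa [len, PreRigid.len] using hlen
  · simpa [steps, PreRigid.steps] using hs

/-- The rigid path with length `n` and vertices `c 0, c 1, ...`, where consecutive vertices are
`U`-equal and the sequence is constant from `n` on. -/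
noncomputable def mk (n : W ⟶ nat C) (c : nat C ⊗ W ⟶ X) (h : UEq c (succ C ▷ W ≫ c))
    (h' : lift (lift (snd _ _ ≫ n) (fst _ _) ≫ add C) (snd _ _) ≫ c = snd _ _ ≫ lift n (𝟙 W) ≫ c) :
    W ⟶ Rigid X :=
  equalizer.lift (lift n (curry (exists_path_of_uEq h).choose)) (by
    obtain ⟨h0, h1⟩ := (exists_path_of_uEq h).choose_spec
    apply PreRigid.comp_lhs_eq_comp_rhs
    · simp only [PreRigid.comp_steps_lift, app_curry, lift_fst_snd, Category.id_comp, h0, h1,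
        Category.assoc]
      congr 1
      ext <;> simp
    · simpa only [PreRigid.comp_steps_lift, PreRigid.comp_len_lift, app_curry, Category.assoc, h0,
        comp_lift_assoc, Category.comp_id] using h')

section mk

variable {n : W ⟶ nat C} {c : nat C ⊗ W ⟶ X} {h : UEq c (succ C ▷ W ≫ c)}
    {h' : lift (lift (snd _ _ ≫ n) (fst _ _) ≫ add C) (snd _ _) ≫ c = snd _ _ ≫ lift n (𝟙 W) ≫ c}

theorem mk_ι : mk n c h h' ≫ ι = lift n (curry (exists_path_of_uEq h).choose) :=
  equalizer.lift_ι _ _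

theorem mk_len : mk n c h h' ≫ len = n := by
  rw [len, PreRigid.comp_len, mk_ι, PreRigid.len, lift_fst]

theorem vertex_mk (v : T ⟶ W) (k : T ⟶ nat C) : vertex (v ≫ mk n c h h') k = lift k v ≫ c := by
  rw [vertex, Category.assoc, steps, PreRigid.comp_steps, mk_ι, PreRigid.steps, lift_snd, app_curry,
    Category.assoc, (exists_path_of_uEq h).choose_spec.1]

end mk

/-- All vertices of a rigid path are `U`-equal to the first one: where the end points of the
interval agree, consecutive vertices are equal. -/
theorem uEq_vertex (σ : T ⟶ Rigid X) (k : T ⟶ nat C) :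
    UEq (vertex σ (toUnit _ ≫ zero C)) (vertex σ k) := by
  intro V v hv
  have key : vertex (snd _ _ ≫ v ≫ σ) (fst (nat C) V) =
      snd _ _ ≫ vertex (v ≫ σ) (toUnit _ ≫ zero C) := by
    refine nat_tensor_hom_ext (𝟙 _) ?_ ?_ ?_
    · simp [comp_vertex]
    · have e := uEq_vertex_succ (snd _ _ ≫ v ≫ σ) (fst (nat C) V) (𝟙 _) (by
        rw [← comp_toUnit (snd (nat C) V), Category.assoc, Category.assoc, hv])
      simpa [comp_vertex] using e.symm
    · simp
  have h := congr(lift (v ≫ k) (𝟙 V) ≫ $key)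
  simpa [comp_vertex] using h.symm

end Rigid

namespace PreExpansion

variable {X T : C}

/-- The four equations that define expansions, for generalized elements. -/
theorem comp_lhs_eq_comp_rhs_iff (e : T ⟶ PreExpansion X) :
    e ≫ expansionLHS X = e ≫ expansionRHS X ↔
      (app (d e) (toUnit _ ≫ zero C) = toUnit _ ≫ zero C ∧
        app (d e) (σ e ≫ Rigid.len) = θ e ≫ Rigid.len) ∧
      app (d (snd (nat C) T ≫ e)) (fst _ _ ≫ succ C) =
        lift (app (d (snd (nat C) T ≫ e)) (fst _ _))
          (app (b (snd (nat C) T ≫ e)) (fst _ _) ≫ bit C) ≫ add C ∧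
      Rigid.vertex (σ (snd (nat C) T ≫ e)) (fst _ _) =
        Rigid.vertex (θ (snd (nat C) T ≫ e)) (app (d (snd (nat C) T ≫ e)) (fst _ _)) := by
  have hl {A B : C} {a a' : T ⟶ A} {b b' : T ⟶ B} : lift a b = lift a' b' ↔ a = a' ∧ b = b' :=
    ⟨fun h => ⟨by simpa using congr($h ≫ fst _ _), by simpa using congr($h ≫ snd _ _)⟩,
      fun h => by rw [h.1, h.2]⟩
  have hl' {A B : C} {a a' : nat C ⊗ T ⟶ A} {b b' : nat C ⊗ T ⟶ B} :
      lift a b = lift a' b' ↔ a = a' ∧ b = b' :=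
    ⟨fun h => ⟨by simpa using congr($h ≫ fst _ _), by simpa using congr($h ≫ snd _ _)⟩,
      fun h => by rw [h.1, h.2]⟩
  rw [expansionLHS, expansionRHS, comp_lift _ _ (curry _), comp_lift _ _ (curry _),
    ← curry_natural_left, ← curry_natural_left, hl, curry_injective.eq_iff]
  simp only [comp_lift, comp_lift_assoc, comp_app, comp_app_assoc, comp_σ, comp_σ_assoc, comp_θ,
    comp_θ_assoc, comp_d, comp_b, comp_toUnit_assoc, Category.comp_id,
    whiskerLeft_fst, whiskerLeft_snd, whiskerLeft_fst_assoc, Rigid.comp_vertex]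
  rw [hl, hl']

end PreExpansion

/-- `σ` is the expansion of `θ` along the degeneracy operator `d`, with increments `b`, where all
four are generalized elements defined on `T`. -/
structure IsExpansion {X T : C} (σ θ : T ⟶ Rigid X) (d : nat C ⊗ T ⟶ nat C)
    (b : nat C ⊗ T ⟶ two C) : Prop where
  map_zero : lift (toUnit T ≫ zero C) (𝟙 T) ≫ d = toUnit T ≫ zero C
  map_len : lift (σ ≫ Rigid.len) (𝟙 T) ≫ d = θ ≫ Rigid.len
  map_succ : succ C ▷ T ≫ d = lift d (b ≫ bit C) ≫ add C
  vertex_eq : Rigid.vertex (snd _ _ ≫ σ) (fst (nat C) T) = Rigid.vertex (snd _ _ ≫ θ) d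

theorem IsExpansion.exists_eq {X T : C} {σ θ : T ⟶ Rigid X} {d : nat C ⊗ T ⟶ nat C}
    {b : nat C ⊗ T ⟶ two C} (h : IsExpansion σ θ d b) :
    ∃ e : T ⟶ Expansion X, e ≫ Expansion.left = σ ∧ e ≫ Expansion.right = θ := by
  let e : T ⟶ PreExpansion X := lift σ (lift θ (lift (curry d) (curry b)))
  have hσ : PreExpansion.σ e = σ := lift_fst _ _
  have hθ : PreExpansion.θ e = θ := by simp [e, PreExpansion.θ]
  have hd : PreExpansion.d e = curry d := by simp [e, PreExpansion.d]
  have hb : PreExpansion.b e = curry b := by simp [e, PreExpansion.b]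
  have he : e ≫ expansionLHS X = e ≫ expansionRHS X := by
    have hs : lift (fst (nat C) T ≫ succ C) (snd _ _) = succ C ▷ T := by ext <;> simp
    have ha {A Z : C} (a : A ⊗ T ⟶ Z) (k : T ⟶ A) : app (curry a) k = lift k (𝟙 T) ≫ a := by
      rw [← app_curry, Category.id_comp]
    rw [PreExpansion.comp_lhs_eq_comp_rhs_iff, ← PreExpansion.comp_σ, ← PreExpansion.comp_θ,
      ← PreExpansion.comp_d, ← PreExpansion.comp_b, hσ, hθ, hd, hb]
    simp only [app_curry, ha, hs, lift_fst_snd, Category.id_comp]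
    exact ⟨⟨h.map_zero, h.map_len⟩, h.map_succ, h.vertex_eq⟩
  obtain ⟨g, hg⟩ : ∃ g : T ⟶ Expansion X, g ≫ Expansion.ι = e := ⟨_, equalizer.lift_ι e he⟩
  exact ⟨g, by rw [Expansion.left, PreExpansion.comp_σ, hg, hσ],
    by rw [Expansion.right, PreExpansion.comp_θ, hg, hθ]⟩

namespace Expansion

variable {X T : C}

theorem exists_isExpansion (ρ : T ⟶ Expansion X) :
    ∃ (d : nat C ⊗ T ⟶ nat C) (b : nat C ⊗ T ⟶ two C), IsExpansion (ρ ≫ left) (ρ ≫ right) d b := by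
  obtain ⟨⟨h0, hlen⟩, hsucc, hv⟩ := (PreExpansion.comp_lhs_eq_comp_rhs_iff (ρ ≫ ι)).1 (by
    rw [Category.assoc, Category.assoc, condition])
  refine ⟨app (snd _ _ ≫ PreExpansion.d (ρ ≫ ι)) (fst _ _),
    app (snd _ _ ≫ PreExpansion.b (ρ ≫ ι)) (fst _ _), ⟨?_, ?_, ?_, ?_⟩⟩
  · simpa [comp_app] using h0
  · simpa [comp_app, left, right, PreExpansion.comp_σ_assoc, PreExpansion.comp_θ_assoc] using hlen
  · simpa [comp_app, PreExpansion.comp_d, PreExpansion.comp_b] using hsucc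
  · simpa [left, right, PreExpansion.comp_σ, PreExpansion.comp_θ, PreExpansion.comp_d] using hv

end Expansion

/-! ### Prepending a vertex, and the target of a path -/

theorem uEq_of_cases {W X : C} {f g : nat C ⊗ W ⟶ X}
    (h0 : UEq (lift (toUnit W ≫ zero C) (𝟙 W) ≫ f) (lift (toUnit W ≫ zero C) (𝟙 W) ≫ g))
    (h1 : UEq (succ C ▷ W ≫ f) (succ C ▷ W ≫ g)) : UEq f g := by
  intro V v hv
  have key : nat C ◁ (v ≫ snd _ _) ≫ f = nat C ◁ (v ≫ snd _ _) ≫ g := by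
    apply nat_cases_ext
    · simpa [comp_lift_assoc, ← Category.assoc, lift_whiskerLeft] using h0 (v ≫ snd _ _) hv
    · rw [← whisker_exchange_assoc, ← whisker_exchange_assoc]
      exact h1 _ (by rw [← comp_toUnit (snd (nat C) V), Category.assoc, Category.assoc, hv])
  have hk (f : nat C ⊗ W ⟶ X) : v ≫ f = lift (v ≫ fst _ _) (𝟙 V) ≫ nat C ◁ (v ≫ snd _ _) ≫ f := by
    rw [lift_whiskerLeft_assoc]
    congr 1
    ext <;> simp
  rw [hk f, hk g, key]

namespace Rigid

variable {X Y T W : C}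

/-- To compare rigid paths of equal length, the first vertex and the later ones can be treated
separately. -/
theorem hom_ext_of_cases {σ τ : T ⟶ Rigid X} (hlen : σ ≫ len = τ ≫ len)
    (h0 : vertex σ (toUnit _ ≫ zero C) = vertex τ (toUnit _ ≫ zero C))
    (h1 : vertex (snd _ _ ≫ σ) (fst (nat C) T ≫ succ C) =
      vertex (snd _ _ ≫ τ) (fst (nat C) T ≫ succ C)) : σ = τ := by
  refine hom_ext hlen (nat_cases_ext ?_ ?_)
  · simpa [comp_vertex] using h0
  · simpa [comp_vertex] using h1

/-- The rigid path of length `0` at a point. -/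
noncomputable def const (x : W ⟶ X) : W ⟶ Rigid X :=
  mk (toUnit _ ≫ zero C) (snd _ _ ≫ x) (by simpa using UEq.refl _) (by simp)

theorem const_len (x : W ⟶ X) : const x ≫ len = toUnit _ ≫ zero C := mk_len

theorem vertex_const (x : W ⟶ X) (v : T ⟶ W) (k : T ⟶ nat C) :
    vertex (v ≫ const x) k = v ≫ x := by
  rw [const, vertex_mk]; simp

theorem comp_const (v : T ⟶ W) (x : W ⟶ X) : v ≫ const x = const (v ≫ x) := by
  refine hom_ext ?_ ?_
  · simp [const_len]
  · rw [← Category.assoc, vertex_const, vertex_const, Category.assoc]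

/-- The rigid path obtained from `ρ` by prepending the vertex `x`. -/
noncomputable def cons (x : W ⟶ X) (ρ : W ⟶ Rigid X) (h : UEq x (vertex ρ (toUnit _ ≫ zero C))) :
    W ⟶ Rigid X :=
  mk (ρ ≫ len ≫ succ C) (natCases x (vertex (snd _ _ ≫ ρ) (fst _ _)))
    (by
      apply uEq_of_cases
      · rw [lift_zero_natCases, succ_natCases, comp_vertex]
        simpa using h
      · rw [succ_natCases, comp_vertex]
        simpa using uEq_vertex_succ (snd _ _ ≫ ρ) (fst _ _))
    (by
      have e : lift (snd (nat C) W ≫ ρ ≫ len ≫ succ C) (fst (nat C) W) ≫ add C =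
          (lift (snd (nat C) W ≫ ρ ≫ len) (fst (nat C) W) ≫ add C) ≫ succ C := by
        rw [Category.assoc, ← succ_add]; simp
      have e' : lift (ρ ≫ len ≫ succ C) (𝟙 W) = lift ((ρ ≫ len) ≫ succ C) (𝟙 W) := by simp
      rw [e, e', lift_succ_natCases, lift_succ_natCases, comp_vertex, comp_vertex, comp_vertex]
      simpa using vertex_add_len (snd _ _ ≫ ρ) (fst _ _))

section cons

variable {x : W ⟶ X} {ρ : W ⟶ Rigid X} {h : UEq x (vertex ρ (toUnit _ ≫ zero C))}

theorem cons_len : cons x ρ h ≫ len = ρ ≫ len ≫ succ C := mk_len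

theorem vertex_cons_zero (v : T ⟶ W) : vertex (v ≫ cons x ρ h) (toUnit _ ≫ zero C) = v ≫ x := by
  rw [cons, vertex_mk, lift_zero_natCases]

theorem vertex_cons_succ (v : T ⟶ W) (k : T ⟶ nat C) :
    vertex (v ≫ cons x ρ h) (k ≫ succ C) = vertex (v ≫ ρ) k := by
  rw [cons, vertex_mk, lift_succ_natCases, comp_vertex]; simp

theorem vertex_cons_zero' : vertex (cons x ρ h) (toUnit _ ≫ zero C) = x := by
  simpa using vertex_cons_zero (h := h) (𝟙 W)

theorem comp_cons (v : T ⟶ W) (h' : UEq (v ≫ x) (vertex (v ≫ ρ) (toUnit _ ≫ zero C))) :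
    v ≫ cons x ρ h = cons (v ≫ x) (v ≫ ρ) h' := by
  refine hom_ext_of_cases ?_ ?_ ?_
  · simp [cons_len]
  · rw [vertex_cons_zero, vertex_cons_zero']
  · rw [← Category.assoc, vertex_cons_succ, vertex_cons_succ, Category.assoc]

theorem cons_map (f : X ⟶ Y) (h' : UEq (x ≫ f) (vertex (ρ ≫ map f) (toUnit _ ≫ zero C))) :
    cons x ρ h ≫ map f = cons (x ≫ f) (ρ ≫ map f) h' := by
  refine hom_ext_of_cases ?_ ?_ ?_
  · rw [Category.assoc, map_len, cons_len, cons_len, Category.assoc, ← Category.assoc (map f),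
      map_len]
  · rw [vertex_map, vertex_cons_zero', vertex_cons_zero']
  · rw [← Category.assoc, vertex_map, vertex_cons_succ, vertex_cons_succ, ← Category.assoc,
      vertex_map]

end cons

end Rigid

section expansion

variable {X T : C}

theorem IsExpansion.mk_eq {σ θ : T ⟶ Rigid X} {d : nat C ⊗ T ⟶ nat C} {b : nat C ⊗ T ⟶ two C}
    (h : IsExpansion σ θ d b) : σ ≫ PathObject.mk X = θ ≫ PathObject.mk X := by
  obtain ⟨e, rfl, rfl⟩ := h.exists_eq
  rw [Category.assoc, Category.assoc, PathObject.condition]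

/-- Prepending a vertex is compatible with expansions: the degeneracy operator `d` is replaced by
`0 ↦ 0`, `k + 1 ↦ d k + 1`. -/
theorem IsExpansion.cons {σ θ : T ⟶ Rigid X} {d : nat C ⊗ T ⟶ nat C} {b : nat C ⊗ T ⟶ two C}
    (h : IsExpansion σ θ d b) (x : T ⟶ X) (hσ : UEq x (Rigid.vertex σ (toUnit _ ≫ zero C)))
    (hθ : UEq x (Rigid.vertex θ (toUnit _ ≫ zero C))) :
    IsExpansion (Rigid.cons x σ hσ) (Rigid.cons x θ hθ)
      (natCases (toUnit _ ≫ zero C) (d ≫ succ C)) (natCases (toUnit _ ≫ bit1 C) b) where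
  map_zero := by rw [lift_zero_natCases, Category.id_comp]
  map_len := by
    have e : lift (σ ≫ Rigid.len ≫ succ C) (𝟙 T) = lift ((σ ≫ Rigid.len) ≫ succ C) (𝟙 T) := by
      simp
    rw [Rigid.cons_len, Rigid.cons_len, e, lift_succ_natCases, ← Category.assoc, h.map_len,
      Category.assoc]
  map_succ := by
    apply nat_cases_ext
    · rw [succ_natCases, comp_lift_assoc, lift_zero_natCases, ← Category.assoc, h.map_zero,
        ← Category.assoc _ (natCases _ _) (bit C), lift_zero_natCases, Category.id_comp,
        Category.id_comp, Category.assoc, Category.assoc, bit1_bit,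
        ← Category.assoc (toUnit T) (zero C), add_succ, ← Category.assoc,
        add_zero, Category.assoc]
    · rw [succ_natCases, comp_lift_assoc, succ_natCases, ← Category.assoc, h.map_succ,
        ← Category.assoc, succ_natCases, succ_add, Category.assoc]
  vertex_eq := by
    apply nat_cases_ext
    · simp only [Rigid.comp_vertex, lift_zero_natCases]
      simp [Rigid.vertex_cons_zero']
    · simp only [Rigid.comp_vertex, succ_natCases, whiskerRight_fst, whiskerRight_snd_assoc]
      rw [Rigid.vertex_cons_succ, Rigid.vertex_cons_succ, h.vertex_eq]

/-- Repeating the first vertex is an expansion. -/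
theorem isExpansion_cons (σ : T ⟶ Rigid X) (h : UEq _ (Rigid.vertex σ (toUnit _ ≫ zero C))) :
    IsExpansion (Rigid.cons (Rigid.vertex σ (toUnit _ ≫ zero C)) σ h) σ
      (natCases (toUnit _ ≫ zero C) (fst _ _))
      (natCases (toUnit _ ≫ bit0 C) (toUnit _ ≫ bit1 C)) where
  map_zero := by rw [lift_zero_natCases, Category.id_comp]
  map_len := by
    have e : lift (σ ≫ Rigid.len ≫ succ C) (𝟙 T) = lift ((σ ≫ Rigid.len) ≫ succ C) (𝟙 T) := by
      simp
    rw [Rigid.cons_len, e, lift_succ_natCases, lift_fst]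
  map_succ := by
    rw [succ_natCases]
    apply nat_cases_ext
    · rw [comp_lift_assoc, lift_zero_natCases, ← Category.assoc _ (natCases _ _) (bit C),
        lift_zero_natCases, Category.id_comp, Category.id_comp, Category.assoc, bit0_bit, add_zero,
        lift_fst]
    · rw [comp_lift_assoc, succ_natCases, ← Category.assoc, succ_natCases, Category.assoc,
        bit1_bit, ← Category.assoc, add_succ, ← Category.assoc, add_zero, whiskerRight_fst]
  vertex_eq := by
    apply nat_cases_ext
    · simp only [Rigid.comp_vertex, lift_zero_natCases]
      simp [Rigid.vertex_cons_zero']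
    · simp only [Rigid.comp_vertex, succ_natCases, whiskerRight_fst, whiskerRight_snd_assoc]
      rw [Rigid.vertex_cons_succ]

end expansion

namespace PathObject

variable {X Y : C}

theorem exists_desc (k : Rigid X ⟶ Y) (h : Expansion.left ≫ k = Expansion.right ≫ k) :
    ∃ g : PathObject X ⟶ Y, mk X ≫ g = k :=
  ⟨coequalizer.desc k h, coequalizer.π_desc _ _⟩

theorem vertex_len_left_eq :
    Rigid.vertex (Expansion.left (X := X)) (Expansion.left ≫ Rigid.len) =
      Rigid.vertex Expansion.right (Expansion.right ≫ Rigid.len) := by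
  obtain ⟨d, b, h⟩ := Expansion.exists_isExpansion (𝟙 (Expansion X))
  rw [Category.id_comp, Category.id_comp] at h
  have e := congr(lift (Expansion.left ≫ Rigid.len) (𝟙 _) ≫ $(h.vertex_eq))
  simpa [Rigid.comp_vertex, h.map_len] using e

/-- The target map of the path object: the last vertex. -/
noncomputable def target (X : C) : PathObject X ⟶ X :=
  coequalizer.desc (Rigid.vertex (𝟙 _) Rigid.len) (by
    rw [Rigid.comp_vertex, Rigid.comp_vertex]
    simpa using vertex_len_left_eq)

theorem mk_target (X : C) : mk X ≫ target X = Rigid.vertex (𝟙 _) Rigid.len :=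
  coequalizer.π_desc _ _

theorem map_target (f : X ⟶ Y) : map f ≫ target Y = target X ≫ f := by
  apply hom_ext
  rw [← Category.assoc, ← Category.assoc, mk_map, mk_target, Category.assoc, mk_target,
    Rigid.comp_vertex, ← Rigid.vertex_map, Rigid.map_len]
  simp

/-- The end points of a path are `U`-equal. The morphism to `X ^ I` that witnesses this for
rigid paths descends to the path object, since it is determined by its end points. -/
theorem uEq_source_target (X : C) : UEq (source X) (target X) := by
  obtain ⟨p, h0, h1⟩ := exists_path_of_uEq (Rigid.uEq_vertex (𝟙 (Rigid X)) Rigid.len)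
  rw [← mk_target] at h1
  rw [← comp_toUnit (𝟙 (Rigid X)), Category.id_comp, ← mk_source] at h0
  have hp : Expansion.left ≫ p = Expansion.right ≫ p := by
    apply ival_hom_ext
    · rw [Category.assoc, Category.assoc, h0, ← Category.assoc, condition, Category.assoc]
    · rw [Category.assoc, Category.assoc, h1, ← Category.assoc, condition, Category.assoc]
  obtain ⟨q, rfl⟩ := exists_desc p hp
  have e0 : q ≫ evalAt (pt0 C) X = source X := hom_ext (by rw [← h0, Category.assoc])
  have e1 : q ≫ evalAt (pt1 C) X = target X := hom_ext (by rw [← h1, Category.assoc])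
  rw [← e0, ← e1]
  exact UEq.of_path _

end PathObject

/-! ### Transports -/

/-- A transport on `f : X ⟶ Y` moves every generalized element `x` of `X`, naturally, to an element
`U`-equal to `x` over a given element `y` that is `U`-equal to `f x`. Moving `x` to `f x` itself
need not give back `x`. -/
structure Transport {X Y : C} (f : X ⟶ Y) where
  /-- The element over `y` to which `x` is moved. -/
  tr {T : C} (x : T ⟶ X) (y : T ⟶ Y) (h : UEq (x ≫ f) y) : T ⟶ X
  tr_comp {T : C} (x : T ⟶ X) (y : T ⟶ Y) (h : UEq (x ≫ f) y) : tr x y h ≫ f = y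
  uEq_tr {T : C} (x : T ⟶ X) (y : T ⟶ Y) (h : UEq (x ≫ f) y) : UEq x (tr x y h)
  comp_tr {S T : C} (v : S ⟶ T) (x : T ⟶ X) (y : T ⟶ Y) (h : UEq (x ≫ f) y)
    (h' : UEq ((v ≫ x) ≫ f) (v ≫ y)) : v ≫ tr x y h = tr (v ≫ x) (v ≫ y) h'

namespace Transport

variable {X Y Z : C}

theorem tr_congr {f : X ⟶ Y} (t : Transport f) {T : C} {x x' : T ⟶ X} {y y' : T ⟶ Y}
    {h : UEq (x ≫ f) y} (hx : x = x') (hy : y = y') :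
    t.tr x y h = t.tr x' y' (by rwa [← hx, ← hy]) := by
  subst hx hy; rfl

/-- The transport on an isomorphism. -/
noncomputable def ofIsIso (f : X ⟶ Y) [IsIso f] : Transport f where
  tr _ y _ := y ≫ inv f
  tr_comp _ _ _ := by simp
  uEq_tr x y h := by simpa using h.postcomp (inv f)
  comp_tr _ _ _ _ _ := by simp

/-- Transports compose. -/
def comp {f : X ⟶ Y} {g : Y ⟶ Z} (t : Transport f) (s : Transport g) : Transport (f ≫ g) where
  tr x z h := t.tr x (s.tr (x ≫ f) z (by simpa using h)) (s.uEq_tr _ _ _)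
  tr_comp x z h := by rw [← Category.assoc, t.tr_comp, s.tr_comp]
  uEq_tr x z h := t.uEq_tr _ _ _
  comp_tr v x z h h' := by
    have e := s.comp_tr v (x ≫ f) z (by simpa using h) (by simpa using h')
    rw [t.comp_tr v _ _ _ (by rw [Category.assoc]; exact (s.uEq_tr _ _ _).precomp v)]
    exact t.tr_congr rfl (e.trans (s.tr_congr (Category.assoc _ _ _).symm rfl))

/-- Transports are stable under base change: `(x, y')` is moved to `(tr x (g y₁), y₁)`. -/
noncomputable def baseChange {X' Y' : C} {g' : X' ⟶ X} {f' : X' ⟶ Y'} {f : X ⟶ Y} {g : Y' ⟶ Y}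
    (hp : IsPullback g' f' f g) (t : Transport f) : Transport f' where
  tr x y h := hp.lift (t.tr (x ≫ g') (y ≫ g) (by
    have := h.postcomp g
    rwa [Category.assoc, ← hp.w, ← Category.assoc] at this)) y (t.tr_comp _ _ _)
  tr_comp x y h := hp.lift_snd _ _ _
  uEq_tr x y h := fun V v hv => by
    apply hp.hom_ext
    · rw [Category.assoc, Category.assoc, hp.lift_fst]
      exact t.uEq_tr _ _ _ v hv
    · rw [Category.assoc, Category.assoc, hp.lift_snd]
      exact h v hv
  comp_tr v x y h h' := by
    apply hp.hom_ext
    · rw [Category.assoc, hp.lift_fst, hp.lift_fst, t.comp_tr v]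
      · exact t.tr_congr (Category.assoc _ _ _).symm (Category.assoc _ _ _).symm
      · have := h'.postcomp g
        rw [Category.assoc, ← hp.w] at this
        simpa using this
    · rw [Category.assoc, hp.lift_snd, hp.lift_snd]

/-- Every object has a transport over the terminal object. -/
def terminal (X : C) : Transport (toUnit X) where
  tr x _ _ := x
  tr_comp _ _ _ := toUnit_unique _ _
  uEq_tr _ _ _ := UEq.refl _
  comp_tr _ _ _ _ _ := rfl

end Transport

/-! ### From Hurewicz connections to transports -/

namespace Rigid

variable {X T W : C}

theorem vertex_const' (x : W ⟶ X) (k : W ⟶ nat C) : vertex (const x) k = x := by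
  simpa using vertex_const x (𝟙 W) k

/-- The rigid path of length `1` with vertices `a` and `b`. -/
noncomputable def edge (a b : W ⟶ X) (h : UEq a b) : W ⟶ Rigid X :=
  cons a (const b) (by rwa [vertex_const'])

theorem comp_edge (v : T ⟶ W) (a b : W ⟶ X) (h : UEq a b) :
    v ≫ edge a b h = edge (v ≫ a) (v ≫ b) (h.precomp v) := by
  have hc := comp_const v b
  rw [edge, comp_cons _ (by
    rw [vertex_const]; exact h.precomp v)]
  simp only [hc]
  rfl

theorem edge_mk_source (a b : W ⟶ X) (h : UEq a b) :
    (edge a b h ≫ PathObject.mk X) ≫ PathObject.source X = a := by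
  rw [Category.assoc, PathObject.mk_source, comp_vertex, Category.comp_id, comp_toUnit_assoc, edge,
    vertex_cons_zero']

theorem edge_mk_target (a b : W ⟶ X) (h : UEq a b) :
    (edge a b h ≫ PathObject.mk X) ≫ PathObject.target X = b := by
  rw [Category.assoc, PathObject.mk_target, comp_vertex, Category.comp_id, edge, cons_len,
    ← Category.assoc]
  have := vertex_cons_succ (h := by rwa [vertex_const'])
    (x := a) (ρ := const b) (𝟙 W) (const b ≫ len)
  rw [Category.id_comp, vertex_const, Category.id_comp] at this
  exact this

end Rigid

section connection

variable {X Y : C} {f : X ⟶ Y}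

theorem HurewiczConnection.h_map (c : HurewiczConnection f) :
    c.h ≫ PathObject.map f = pullback.fst _ _ := by
  have h := congr($c.isSection ≫ pullback.fst _ _)
  rwa [Category.assoc, pathLifting, pullback.lift_fst, Category.id_comp] at h

theorem HurewiczConnection.h_source (c : HurewiczConnection f) :
    c.h ≫ PathObject.source X = pullback.snd _ _ := by
  have h := congr($c.isSection ≫ pullback.snd _ _)
  rwa [Category.assoc, pathLifting, pullback.lift_snd, Category.id_comp] at h

/-- A Hurewicz connection moves `x` to the end of the lift of the path of length `1` from `f x`
to `y`. -/
noncomputable def HurewiczConnection.transport (c : HurewiczConnection f) : Transport f where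
  tr x y h := pullback.lift (Rigid.edge _ _ h ≫ PathObject.mk Y) x
    (Rigid.edge_mk_source _ _ _) ≫ c.h ≫ PathObject.target X
  tr_comp x y h := by
    rw [Category.assoc, Category.assoc, ← PathObject.map_target, ← Category.assoc c.h, c.h_map,
      pullback.lift_fst_assoc, Rigid.edge_mk_target]
  uEq_tr x y h := by
    have e := (PathObject.uEq_source_target X).precomp (pullback.lift
      (Rigid.edge _ _ h ≫ PathObject.mk Y) x (Rigid.edge_mk_source _ _ _) ≫ c.h)
    rw [Category.assoc, c.h_source, pullback.lift_snd, Category.assoc] at e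
    exact e
  comp_tr v x y h h' := by
    rw [← Category.assoc]
    congr 1
    apply pullback.hom_ext
    · rw [Category.assoc, pullback.lift_fst, pullback.lift_fst, ← Category.assoc, Rigid.comp_edge]
      simp only [Category.assoc]
    · rw [Category.assoc, pullback.lift_snd, pullback.lift_snd]

end connection

/-! ### From transports to Hurewicz connections -/

namespace Transport

variable {X Y : C} {f : X ⟶ Y} (t : Transport f) {T W : C}

theorem uEq_vertex (σ : W ⟶ Rigid Y) (x : W ⟶ X)
    (hx : x ≫ f = Rigid.vertex σ (toUnit _ ≫ zero C)) (k : W ⟶ nat C) :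
    UEq (x ≫ f) (Rigid.vertex σ k) := by
  rw [hx]
  exact Rigid.uEq_vertex σ k

theorem uEq_vertex' (σ : W ⟶ Rigid Y) (x : W ⟶ X)
    (hx : x ≫ f = Rigid.vertex σ (toUnit _ ≫ zero C)) (v : T ⟶ W) (k : T ⟶ nat C) :
    UEq ((v ≫ x) ≫ f) (Rigid.vertex (v ≫ σ) k) :=
  uEq_vertex _ _ (by rw [Category.assoc, hx, Rigid.comp_vertex, comp_toUnit_assoc]) k

/-- The lift of a rigid path `σ` that is obtained by moving the single point `x` to all
vertices of `σ`. Its first vertex need not be `x`. -/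
noncomputable def rigid (σ : W ⟶ Rigid Y) (x : W ⟶ X)
    (hx : x ≫ f = Rigid.vertex σ (toUnit _ ≫ zero C)) : W ⟶ Rigid X :=
  Rigid.mk (σ ≫ Rigid.len)
    (t.tr (snd _ _ ≫ x) (Rigid.vertex (snd _ _ ≫ σ) (fst _ _)) (uEq_vertex' σ x hx _ _))
    (((t.uEq_tr _ _ _).symm).trans (by
      have e := (t.uEq_tr _ _ (uEq_vertex' σ x hx (snd _ _) (fst _ _))).precomp (succ C ▷ W)
      rwa [whiskerRight_snd_assoc] at e))
    (by
      rw [← Category.assoc (snd _ _) (lift _ (𝟙 W)), t.comp_tr _ _ _ _ (by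
        rw [Rigid.comp_vertex]; simpa using uEq_vertex' σ x hx (snd (nat C) W) _),
        t.comp_tr (snd _ _ ≫ lift _ _) _ _ _ (by
        rw [Rigid.comp_vertex]; simpa using uEq_vertex' σ x hx (snd (nat C) W) _)]
      apply t.tr_congr
      · simp
      · simpa [Rigid.comp_vertex] using Rigid.vertex_add_len (snd _ _ ≫ σ) (fst (nat C) W))

section rigid

variable {t} {σ : W ⟶ Rigid Y} {x : W ⟶ X} {hx : x ≫ f = Rigid.vertex σ (toUnit _ ≫ zero C)}

theorem rigid_len : t.rigid σ x hx ≫ Rigid.len = σ ≫ Rigid.len := Rigid.mk_len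

theorem vertex_rigid (v : T ⟶ W) (k : T ⟶ nat C) :
    Rigid.vertex (v ≫ t.rigid σ x hx) k =
      t.tr (v ≫ x) (Rigid.vertex (v ≫ σ) k) (uEq_vertex' σ x hx v k) := by
  rw [rigid, Rigid.vertex_mk, t.comp_tr _ _ _ _ (by
    rw [Rigid.comp_vertex]; simpa using uEq_vertex' σ x hx v k)]
  apply t.tr_congr
  · simp
  · simp [Rigid.comp_vertex]

theorem uEq_vertex_rigid : UEq x (Rigid.vertex (t.rigid σ x hx) (toUnit _ ≫ zero C)) := by
  have e := vertex_rigid (t := t) (hx := hx) (𝟙 W) (toUnit _ ≫ zero C)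
  rw [Category.id_comp] at e
  rw [e]
  simpa using t.uEq_tr _ _ (uEq_vertex' σ x hx (𝟙 W) (toUnit _ ≫ zero C))

theorem comp_rigid (v : T ⟶ W) :
    v ≫ t.rigid σ x hx = t.rigid (v ≫ σ) (v ≫ x)
      (by rw [Category.assoc, hx, Rigid.comp_vertex, comp_toUnit_assoc]) := by
  refine Rigid.hom_ext ?_ ?_
  · rw [Category.assoc, rigid_len, rigid_len, Category.assoc]
  · rw [← Category.assoc, vertex_rigid, vertex_rigid]
    exact t.tr_congr (Category.assoc _ _ _) (by rw [Category.assoc])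

theorem rigid_map : t.rigid σ x hx ≫ Rigid.map f = σ := by
  refine Rigid.hom_ext ?_ ?_
  · rw [Category.assoc, Rigid.map_len, rigid_len]
  · rw [← Category.assoc, Rigid.vertex_map, vertex_rigid, t.tr_comp]

end rigid

/-- Moving a single point to all vertices of a path respects expansions, with the same degeneracy
operator. -/
theorem isExpansion_rigid {σ θ : W ⟶ Rigid Y} {d : nat C ⊗ W ⟶ nat C} {b : nat C ⊗ W ⟶ two C}
    (h : IsExpansion σ θ d b) (x : W ⟶ X) (hσ : x ≫ f = Rigid.vertex σ (toUnit _ ≫ zero C))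
    (hθ : x ≫ f = Rigid.vertex θ (toUnit _ ≫ zero C)) :
    IsExpansion (t.rigid σ x hσ) (t.rigid θ x hθ) d b where
  map_zero := h.map_zero
  map_len := by rw [rigid_len, rigid_len, h.map_len]
  map_succ := h.map_succ
  vertex_eq := by
    rw [vertex_rigid, vertex_rigid]
    exact t.tr_congr rfl h.vertex_eq

/-- The lift of the class of `σ` that starts at `x`. -/
noncomputable def path (σ : W ⟶ Rigid Y) (x : W ⟶ X)
    (hx : x ≫ f = Rigid.vertex σ (toUnit _ ≫ zero C)) : W ⟶ PathObject X :=
  Rigid.cons x (t.rigid σ x hx) uEq_vertex_rigid ≫ PathObject.mk X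

section path

variable {t} {σ : W ⟶ Rigid Y} {x : W ⟶ X} {hx : x ≫ f = Rigid.vertex σ (toUnit _ ≫ zero C)}

theorem comp_path (v : T ⟶ W) :
    v ≫ t.path σ x hx = t.path (v ≫ σ) (v ≫ x)
      (by rw [Category.assoc, hx, Rigid.comp_vertex, comp_toUnit_assoc]) := by
  have e := comp_rigid (t := t) (hx := hx) v
  rw [path, ← Category.assoc, Rigid.comp_cons _ (by rw [e]; exact uEq_vertex_rigid)]
  simp only [e]
  rfl

theorem path_source : t.path σ x hx ≫ PathObject.source X = x := by
  rw [path, Category.assoc, PathObject.mk_source, Rigid.comp_vertex, Category.comp_id,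
    comp_toUnit_assoc, Rigid.vertex_cons_zero']

/-- The lift lies over the path that repeats the first vertex of `σ`, which is an expansion of
`σ`. -/
theorem path_map : t.path σ x hx ≫ PathObject.map f = σ ≫ PathObject.mk Y := by
  have e := rigid_map (t := t) (hx := hx)
  rw [path, Category.assoc, PathObject.mk_map, ← Category.assoc, Rigid.cons_map f (by
    rw [e, hx]; exact UEq.refl _)]
  simp only [e, hx]
  exact (isExpansion_cons σ (UEq.refl _)).mk_eq

end path

theorem path_eq_of_isExpansion {σ θ : W ⟶ Rigid Y} {d : nat C ⊗ W ⟶ nat C}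
    {b : nat C ⊗ W ⟶ two C} (h : IsExpansion σ θ d b) (x : W ⟶ X)
    (hσ : x ≫ f = Rigid.vertex σ (toUnit _ ≫ zero C))
    (hθ : x ≫ f = Rigid.vertex θ (toUnit _ ≫ zero C)) : t.path σ x hσ = t.path θ x hθ :=
  ((t.isExpansion_rigid h x hσ hθ).cons x uEq_vertex_rigid uEq_vertex_rigid).mk_eq

end Transport

namespace PathObject

variable {X Y Z : C}

/-- The functor `- ⊗ X` preserves the coequalizer that defines the path object. -/
theorem exists_desc_whiskerRight (k : Rigid Y ⊗ X ⟶ Z)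
    (h : Expansion.left ▷ X ≫ k = Expansion.right ▷ X ≫ k) :
    ∃ g : PathObject Y ⊗ X ⟶ Z, mk Y ▷ X ≫ g = k := by
  obtain ⟨g, hg⟩ := exists_desc (curry (lift (snd _ _) (fst _ _) ≫ k)) (by
    rw [← curry_natural_left, ← curry_natural_left, ← Category.assoc, ← Category.assoc,
      ← swap_whisker', ← swap_whisker', Category.assoc, Category.assoc, h])
  refine ⟨lift (snd _ _) (fst _ _) ≫ uncurry g, ?_⟩
  rw [← Category.assoc, ← swap_whisker, Category.assoc, ← uncurry_natural_left, hg, uncurry_curry,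
    ← Category.assoc, swap_swap, Category.id_comp]

instance (X Y : C) : Epi (mk Y ▷ X) where
  left_cancellation {Z} g h e := by
    have e' : curry (lift (snd X _) (fst X _) ≫ g) = curry (lift (snd X _) (fst X _) ≫ h) := by
      apply hom_ext
      rw [← curry_natural_left, ← curry_natural_left, ← Category.assoc, ← Category.assoc,
        ← swap_whisker', Category.assoc, Category.assoc, e]
    rw [← Category.id_comp g, ← Category.id_comp h, ← swap_swap, Category.assoc, Category.assoc,
      curry_injective e']

end PathObject

/-- The lifts `Transport.path` descend from rigid paths to the path object. -/
theorem Transport.nonempty_hurewiczConnection {X Y : C} {f : X ⟶ Y} (t : Transport f) :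
    Nonempty (HurewiczConnection f) := by
  let m : pullback (PathObject.source Y) f ⟶ PathObject Y ⊗ X :=
    lift (pullback.fst _ _) (pullback.snd _ _)
  have hm : Mono m := ⟨fun g h e => pullback.hom_ext
    (by simpa [m] using congr($e ≫ fst _ _)) (by simpa [m] using congr($e ≫ snd _ _))⟩
  let e : Rigid Y ⊗ X ⟶ PathObject Y ⊗ X := PathObject.mk Y ▷ X
  let a : pullback m e ⟶ _ := pullback.fst m e
  let b : pullback m e ⟶ _ := pullback.snd m e
  have hW : IsPullback a b m e := IsPullback.of_hasPullback m e
  have h1 : a ≫ pullback.fst _ _ = (b ≫ fst _ _) ≫ PathObject.mk Y := by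
    simpa [m, e] using congr($hW.w ≫ fst _ _)
  have h2 : a ≫ pullback.snd _ _ = b ≫ snd _ _ := by
    simpa [m, e] using congr($hW.w ≫ snd _ _)
  have hx : (b ≫ snd _ _) ≫ f = Rigid.vertex (b ≫ fst _ _) (toUnit _ ≫ zero C) := by
    rw [← h2, Category.assoc, ← pullback.condition, ← Category.assoc, h1, Category.assoc,
      PathObject.mk_source, Rigid.comp_vertex, Category.comp_id, comp_toUnit_assoc]
  have : Epi a := epi_of_isPullback_of_mono hW
  obtain ⟨g, hg⟩ := exists_desc_of_isPullback (l := Expansion.left ▷ X) (r := Expansion.right ▷ X)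
    hW (by rw [← comp_whiskerRight, PathObject.condition, comp_whiskerRight])
    PathObject.exists_desc_whiskerRight (t.path _ _ hx) (by
      intro T w w' ρ hw hw'
      obtain ⟨d, c, hρ⟩ := Expansion.exists_isExpansion (ρ ≫ fst _ _)
      have e1 : w ≫ b ≫ fst _ _ = (ρ ≫ fst _ _) ≫ Expansion.left := by
        rw [← Category.assoc, hw]; simp
      have e2 : w' ≫ b ≫ fst _ _ = (ρ ≫ fst _ _) ≫ Expansion.right := by
        rw [← Category.assoc, hw']; simp
      have e3 : w ≫ b ≫ snd _ _ = w' ≫ b ≫ snd _ _ := by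
        rw [← Category.assoc, ← Category.assoc, hw, hw']; simp
      rw [Transport.comp_path, Transport.comp_path]
      simp only [e3]
      rw [← e1, ← e2] at hρ
      exact t.path_eq_of_isExpansion hρ _ _ _)
  refine ⟨⟨g, ?_⟩⟩
  rw [← cancel_epi a]
  apply pullback.hom_ext
  · rw [Category.assoc, Category.assoc, pathLifting, pullback.lift_fst, ← Category.assoc, hg,
      Transport.path_map, Category.comp_id, h1]
  · rw [Category.assoc, Category.assoc, pathLifting, pullback.lift_snd, ← Category.assoc, hg,
      Transport.path_source, Category.comp_id, h2]

theorem hurewiczFibrations_iff {X Y : C} (f : X ⟶ Y) :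
    hurewiczFibrations C f ↔ Nonempty (Transport f) :=
  ⟨fun ⟨c⟩ => ⟨c.transport⟩, fun ⟨t⟩ => t.nonempty_hurewiczConnection⟩

end Hurewicz

end HTopos

theorem mainTheorem3 {C : Type u} [Category.{v} C] [CartesianMonoidalCategory C]
    [HTopos.HurewiczTopos C] : HTopos.IsTribe (HTopos.hurewiczFibrations C) where
  of_isIso f _ := (HTopos.hurewiczFibrations_iff f).2 ⟨HTopos.Transport.ofIsIso f⟩
  comp f g := by
    simp only [HTopos.hurewiczFibrations_iff]
    exact fun ⟨t⟩ ⟨s⟩ => ⟨t.comp s⟩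
  baseChange h := by
    simp only [HTopos.hurewiczFibrations_iff]
    exact fun ⟨t⟩ => ⟨t.baseChange h⟩
  fibrant X := (HTopos.hurewiczFibrations_iff _).2 ⟨HTopos.Transport.terminal X⟩
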